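/- For a finite connected graph $G$, the Mostar index is $Mo(G)=\sum_{uv\in E(G)}|n_u-n_v|$, where $n_u$ is the number of vertices of $G$ that are closer to $u$ than to $v$, and $n_v$ is the number of vertices closer to $v$ than to $u$. For integers $a,b\ge 0$ with $2(a+b)\le n-2$, let $C_{n,a,b}$ be the tree obtained from the path $v_1v_2\cdots v_{n-a-b}$ by attaching a pendent vertex $u_i$ to $v_i$ for each $i$ with $2\le i\le a+1$ and each $i$ with $n-a-2b\le i\le n-a-b-1$. For integers $a,b\ge 0$ with $2(a+b)\le n-5$, let $F_{n,a,b}$ be the tree obtained from the path $v_1v_2\cdots v_{n-a-b-2}$ by attaching a pendent vertex $u_1$ to $v_2$, and then attaching a pendent vertex $u_i$ to $v_i$ for each $i$ with $2\le i\le a+2$ and each $i$ with $n-a-2b-2\le i\le n-a-b-3$. Let $n,t$ be integers with $0\le t\le n-4$, and let $\mathcal E(n,t)$ be the set of trees of order $n$ with exactly $t$ vertices of degree two. Then, up to isomorphism, there is exactly one tree $T$ with minimum Mostar index in $\mathcal E(n,t)$, namely: (i) if $n-t=5$, then $T\cong F_{n,0,0}$; if $n-t$ is odd and $n-t\ge 7$,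 then $T\cong F_{n,\lceil\frac{n-t-5}{4}\rceil-1,\lfloor\frac{n-t-5}{4}\rfloor+1}$; (ii) if $n-t$ is even, then $T\cong C_{n,\lceil\frac{n-t}{4}-\frac12\rceil,\lfloor\frac{n-t}{4}-\frac12\rfloor}$. -/

import Mathlib

namespace MostarTrees

open Classical in
/-- The number `n_u` of vertices of `G` that are closer to `u` than to `v`. -/
noncomputable def closer {V : Type*} [Fintype V] (G : SimpleGraph V) (u v : V) : ℕ :=
  (Finset.univ.filter fun w => G.dist w u < G.dist w v).card

/-- `ψ(uv) = |n_u - n_v|`, as a function of the unordered pair `uv`. -/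
noncomputable def psi {V : Type*} [Fintype V] (G : SimpleGraph V) : Sym2 V → ℤ :=
  Sym2.lift ⟨fun u v => |(closer G u v : ℤ) - (closer G v u : ℤ)|, fun _ _ => abs_sub_comm _ _⟩

open Classical in
/-- The Mostar index `Mo(G)`, the sum of `ψ(e)` over all edges `e` of `G`. -/
noncomputable def mostar {V : Type*} [Fintype V] (G : SimpleGraph V) : ℤ :=
  ∑ e ∈ G.edgeFinset, psi G e

open Classical in
/-- The trees with vertex set `V` that have exactly `t` vertices of degree two. -/
def treesDegTwo (V : Type*) [Fintype V] (t : ℕ) : Set (SimpleGraph V) :=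
  {T | T.IsTree ∧ (Finset.univ.filter fun v => T.degree v = 2).card = t}

/-- `T` has minimum Mostar index among the trees on its vertex set with exactly `t` vertices
of degree two. -/
def IsMostarMinimizer {V : Type*} [Fintype V] (t : ℕ) (T : SimpleGraph V) : Prop :=
  T ∈ treesDegTwo V t ∧ ∀ T' ∈ treesDegTwo V t, mostar T ≤ mostar T'

/-- The graph obtained from the path `v_1 v_2 ⋯ v_m` by adding, for each `i ∈ I`, a new vertex
`u_i` adjacent only to `v_(f i)`. The path vertex `v_j` is `Sum.inl` of the element `j - 1` of
`Fin m`, and `u_i` is `Sum.inr i`. -/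
def pathWithPendents (m : ℕ) (I : Set ℕ) (f : ℕ → ℕ) : SimpleGraph (Fin m ⊕ I) where
  Adj
    | Sum.inl x, Sum.inl y => (SimpleGraph.pathGraph m).Adj x y
    | Sum.inl x, Sum.inr i => (x : ℕ) + 1 = f i
    | Sum.inr i, Sum.inl x => (x : ℕ) + 1 = f i
    | Sum.inr _, Sum.inr _ => False
  symm := ⟨by
    rintro (x | i) (y | j) h
    · exact SimpleGraph.Adj.symm h
    · exact h
    · exact h
    · exact h⟩
  loopless := ⟨by
    rintro (x | i) h
    · exact (SimpleGraph.pathGraph m).irrefl h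
    · exact h⟩

/-- `C_{n,a,b}`: the path `v_1 ⋯ v_(n-a-b)` with a pendent vertex `u_i` attached to `v_i` for
`2 ≤ i ≤ a + 1` and for `n - a - 2b ≤ i ≤ n - a - b - 1`. -/
def graphC (n a b : ℕ) :
    SimpleGraph (Fin (n - a - b) ⊕
      (Set.Icc 2 (a + 1) ∪ Set.Icc (n - a - 2 * b) (n - a - b - 1) : Set ℕ)) :=
  pathWithPendents (n - a - b) _ fun i => i

/-- `F_{n,a,b}`: the path `v_1 ⋯ v_(n-a-b-2)` with a pendent vertex `u_1` attached to `v_2`, and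
a pendent vertex `u_i` attached to `v_i` for `2 ≤ i ≤ a + 2` and for
`n - a - 2b - 2 ≤ i ≤ n - a - b - 3`. -/
def graphF (n a b : ℕ) :
    SimpleGraph (Fin (n - a - b - 2) ⊕
      ({1} ∪ Set.Icc 2 (a + 2) ∪ Set.Icc (n - a - 2 * b - 2) (n - a - b - 3) : Set ℕ)) :=
  pathWithPendents (n - a - b - 2) _ fun i => if i = 1 then 2 else i

end MostarTrees

/-! Removing an edge uv of a tree of order n leaves a side of v of some order s, and ψ(uv) = |n -
2s| ≥ n - 2s. Summed without absolute values over a rooted branch of order s, including the edge to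
its root, twice the contribution is at least 2ns minus four times the sum of the subtree orders.
That sum is s(s+1)/2 minus the number of incomparable pairs of vertices. Degree-two vertices are
those with exactly one child, so a branch with N vertices of other degrees has at least `defect N /
4` incomparable pairs. `childSum_bound` and `branchSum_bound` prove this by induction, and show that
equality forces a broom: a path ending in a binary caterpillar, with one extra pendent vertex if N
is even.

At a centroid the branches can be grouped (`exists_groups`, `mostar_trichotomy`). If one branch
holds about half of the vertices, its edge splits the tree into sides with x + y = K vertices not of
degree two, and 2Mo ≥ `base n + defect x + defect y`. Two groups with at least two branches each
give the same kind of bound, but equality would need a group with only two such vertices. Three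
groups of similar size exceed the optimum (`three_groups`). It remains to minimise `defect x +
defect y` with x + y = K; the optimum is unique up to order (`OptimalPair`), and both sides are then
brooms, which determines the tree.

The value K = 5 is special: its optimal pair is (2, 3), but no branch has exactly two vertices of
degree other than two. The pair (4, 1) takes over (`mostar_bound_five`), except for n = 5, where
only the star is left.

Conversely, the trees C and F attain the bound: an upper estimate of their Mostar index suffices,
obtained by comparing the edge values with those of a path (`side_sum_odd`, `side_sum_even`). The
isomorphism comes from covering and counting: two brooms cover the tree, so the map from the model
graph is onto, hence bijective. -/

namespace MostarTrees

open scoped Classical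
open SimpleGraph

/-! ### Branches of a tree: their orders, special vertices and edge contributions. -/

section Branches

variable {V : Type*} [Fintype V] {T : SimpleGraph V}

/-- The vertices closer to `v` than to `u`: for an edge `uv` of a tree, the side of `v`. -/
noncomputable def branch (T : SimpleGraph V) (u v : V) : Finset V :=
  Finset.univ.filter fun w => T.dist w v < T.dist w u

theorem mem_branch {u v w : V} : w ∈ branch T u v ↔ T.dist w v < T.dist w u := by
  simp [branch]

theorem card_branch (u v : V) : (branch T u v).card = closer T v u := by
  unfold branch closer
  congr

theorem head_mem_branch {u v : V} (h : T.Adj u v) : v ∈ branch T u v := by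
  rw [mem_branch, SimpleGraph.dist_self, SimpleGraph.dist_comm, dist_eq_one_iff_adj.2 h]
  exact one_pos

theorem mem_branch_comm (hT : T.IsTree) {u v : V} (h : T.Adj u v) (w : V) :
    w ∈ branch T u v ↔ w ∉ branch T v u := by
  rw [mem_branch, mem_branch]
  have := hT.dist_ne_of_adj w h
  omega

theorem card_branch_add (hT : T.IsTree) {u v : V} (h : T.Adj u v) :
    (branch T u v).card + (branch T v u).card = Fintype.card V := by
  have : branch T v u = (branch T u v)ᶜ := by
    ext w
    rw [Finset.mem_compl, mem_branch_comm hT h, not_not]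
  rw [this, Finset.card_add_card_compl]

theorem psi_mk (hT : T.IsTree) {u v : V} (h : T.Adj u v) :
    psi T s(u, v) = |(Fintype.card V : ℤ) - 2 * (branch T u v).card| := by
  have h1 := card_branch_add hT h
  change |(closer T u v : ℤ) - (closer T v u : ℤ)| = _
  rw [← card_branch, ← card_branch, ← h1]
  congr 1
  push_cast
  ring

/-- A vertex other than `v` has at most one neighbour of `v` closer to it than `v`. -/
theorem eq_of_mem_branch (hT : T.IsTree) {v w w' p : V} (h : T.Adj v w) (h' : T.Adj v w')
    (hp : p ∈ branch T v w) (hp' : p ∈ branch T v w') : w = w' := by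
  have key : ∀ x, T.Adj v x → p ∈ branch T v x →
      ∃ q : T.Walk v p, q.IsPath ∧ q.snd = x := by
    intro x hx hpx
    obtain ⟨q, hq⟩ := hT.connected.exists_walk_length_eq_dist x p
    refine ⟨Walk.cons hx q, ?_, by simp⟩
    apply Walk.isPath_of_length_eq_dist
    rw [mem_branch] at hpx
    have h1 := hT.dist_eq_dist_add_one_of_adj p hx
    rw [Walk.length_cons, hq, T.dist_comm, T.dist_comm (u := v)]
    omega
  obtain ⟨q, hq, rfl⟩ := key w h hp
  obtain ⟨q', hq', rfl⟩ := key w' h' hp'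
  have := (hT.existsUnique_path v p).unique hq hq'
  rw [this]

theorem exists_mem_branch (hT : T.IsTree) {v p : V} (h : p ≠ v) :
    ∃ w, T.Adj v w ∧ p ∈ branch T v w := by
  obtain ⟨q, hq⟩ := hT.connected.exists_walk_length_eq_dist v p
  cases q with
  | nil => exact absurd rfl h
  | @cons _ w _ hw q =>
    refine ⟨w, hw, ?_⟩
    rw [mem_branch]
    have := dist_le q
    rw [Walk.length_cons] at hq
    rw [T.dist_comm, T.dist_comm (v := v)]
    omega

theorem self_notMem_branch (u v : V) : u ∉ branch T u v := by
  simp [mem_branch]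

theorem branch_disjoint (hT : T.IsTree) {v w w' : V} (h : T.Adj v w) (h' : T.Adj v w')
    (hne : w ≠ w') : Disjoint (branch T v w) (branch T v w') :=
  Finset.disjoint_left.2 fun _ hp hp' => hne (eq_of_mem_branch hT h h' hp hp')

theorem mem_branch_iff (hT : T.IsTree) {u v : V} (h : T.Adj u v) (p : V) :
    p ∈ branch T u v ↔ p = v ∨ ∃ w, T.Adj v w ∧ w ≠ u ∧ p ∈ branch T v w := by
  constructor
  · intro hp
    by_cases hpv : p = v
    · exact Or.inl hpv
    · obtain ⟨w, hw, hpw⟩ := exists_mem_branch hT hpv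
      refine Or.inr ⟨w, hw, ?_, hpw⟩
      rintro rfl
      exact (mem_branch_comm hT h p).1 hp hpw
  · rintro (rfl | ⟨w, hw, hwu, hpw⟩)
    · exact head_mem_branch h
    · rw [mem_branch_comm hT h]
      intro hpu
      exact hwu (eq_of_mem_branch hT hw h.symm hpw hpu)

/-- The neighbours of `v` other than `u`. -/
noncomputable def children (T : SimpleGraph V) (u v : V) : Finset V :=
  (T.neighborFinset v).erase u

theorem mem_children {u v w : V} : w ∈ children T u v ↔ w ≠ u ∧ T.Adj v w := by
  simp [children]

theorem children_card {u v : V} (h : T.Adj u v) : (children T u v).card + 1 = T.degree v := by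
  rw [children, Finset.card_erase_add_one]
  · simp
  · simpa using h.symm

theorem branch_eq (hT : T.IsTree) {u v : V} (h : T.Adj u v) :
    branch T u v = insert v ((children T u v).biUnion (branch T v)) := by
  ext p
  rw [mem_branch_iff hT h]
  simp only [Finset.mem_insert, Finset.mem_biUnion, mem_children]
  refine or_congr Iff.rfl (exists_congr fun w => ?_)
  tauto

theorem univ_eq_insert_biUnion (hT : T.IsTree) (r : V) :
    Finset.univ = insert r ((T.neighborFinset r).biUnion (branch T r)) := by
  ext p
  simp only [Finset.mem_univ, Finset.mem_insert, Finset.mem_biUnion, mem_neighborFinset, true_iff]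
  by_cases hp : p = r
  · exact Or.inl hp
  · exact Or.inr (exists_mem_branch hT hp)

theorem notMem_biUnion_branch (s : Finset V) (v : V) : v ∉ s.biUnion (branch T v) := by
  simp [self_notMem_branch]

theorem pairwiseDisjoint_branch (hT : T.IsTree) {v : V} {s : Finset V}
    (hs : s ⊆ T.neighborFinset v) : (s : Set V).PairwiseDisjoint (branch T v) := by
  intro w hw w' hw' hne
  refine branch_disjoint hT ?_ ?_ hne
  · simpa using hs hw
  · simpa using hs hw'

theorem children_subset (u v : V) : children T u v ⊆ T.neighborFinset v :=
  Finset.erase_subset _ _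

theorem branch_ssubset (hT : T.IsTree) {u v w : V} (h : T.Adj u v) (hw : w ∈ children T u v) :
    branch T v w ⊂ branch T u v := by
  rw [branch_eq hT h]
  refine Finset.ssubset_iff_subset_ne.2 ⟨?_, fun heq => ?_⟩
  · exact (Finset.subset_biUnion_of_mem (branch T v) hw).trans (Finset.subset_insert _ _)
  · have : v ∈ branch T v w := by rw [heq]; exact Finset.mem_insert_self _ _
    exact self_notMem_branch v w this

theorem card_branch_eq (hT : T.IsTree) {u v : V} (h : T.Adj u v) :
    (branch T u v).card = 1 + ∑ w ∈ children T u v, (branch T v w).card := by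
  rw [branch_eq hT h, Finset.card_insert_of_notMem (notMem_biUnion_branch _ _),
    Finset.card_biUnion (pairwiseDisjoint_branch hT (children_subset u v)), add_comm]

theorem card_eq_sum_branch (hT : T.IsTree) (r : V) :
    Fintype.card V = 1 + ∑ w ∈ T.neighborFinset r, (branch T r w).card := by
  rw [← Finset.card_univ, univ_eq_insert_biUnion hT r,
    Finset.card_insert_of_notMem (notMem_biUnion_branch _ _),
    Finset.card_biUnion (pairwiseDisjoint_branch hT subset_rfl), add_comm]

/-- The number of vertices in a branch that do not have degree two. -/
noncomputable def special (T : SimpleGraph V) (u v : V) : ℕ :=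
  ((branch T u v).filter fun w => T.degree w ≠ 2).card

theorem special_le (u v : V) : special T u v ≤ (branch T u v).card :=
  Finset.card_filter_le _ _

theorem special_eq (hT : T.IsTree) {u v : V} (h : T.Adj u v) :
    special T u v =
      (if T.degree v = 2 then 0 else 1) + ∑ w ∈ children T u v, special T v w := by
  unfold special
  rw [branch_eq hT h]
  simp only [Finset.card_filter]
  rw [Finset.sum_insert (notMem_biUnion_branch _ _),
    Finset.sum_biUnion (pairwiseDisjoint_branch hT (children_subset u v))]
  congr 1
  split_ifs <;> simp_all

theorem card_special_eq_sum (hT : T.IsTree) (r : V) :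
    (Finset.univ.filter fun w => T.degree w ≠ 2).card =
      (if T.degree r = 2 then 0 else 1) + ∑ w ∈ T.neighborFinset r, special T r w := by
  unfold special
  rw [univ_eq_insert_biUnion hT r]
  simp only [Finset.card_filter]
  rw [Finset.sum_insert (notMem_biUnion_branch _ _),
    Finset.sum_biUnion (pairwiseDisjoint_branch hT subset_rfl)]
  congr 1
  split_ifs <;> simp_all

theorem special_add (hT : T.IsTree) {u v : V} (h : T.Adj u v) :
    special T u v + special T v u = (Finset.univ.filter fun w => T.degree w ≠ 2).card := by
  unfold special
  rw [← Finset.card_union_of_disjoint]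
  · congr 1
    ext w
    have := mem_branch_comm hT h w
    simp only [Finset.mem_union, Finset.mem_filter, Finset.mem_univ, true_and]
    tauto
  · refine Finset.disjoint_left.2 fun w hw hx => ?_
    rw [Finset.mem_filter] at hw hx
    exact (mem_branch_comm hT h w).1 hw.1 hx.1

/-- The only edge leaving a branch is the one it is defined by. -/
theorem eq_of_adj_of_mem_branch (hT : T.IsTree) {u v p q : V} (h : T.Adj u v) (hpq : T.Adj p q)
    (hp : p ∈ branch T u v) (hq : q ∉ branch T u v) : p = v ∧ q = u := by
  by_cases hpv : p = v
  · subst hpv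
    refine ⟨rfl, ?_⟩
    by_contra hqu
    exact hq ((mem_branch_iff hT h q).2 (Or.inr ⟨q, hpq, hqu, head_mem_branch hpq⟩))
  · exfalso
    obtain ⟨w, hw, hvw⟩ := exists_mem_branch hT (Ne.symm hpv)
    rw [mem_branch] at hp hq hvw
    have h1 := hT.dist_eq_dist_add_one_of_adj p h
    have h2 := hT.dist_eq_dist_add_one_of_adj q h
    have h3 := hT.connected.dist_triangle (u := p) (v := q) (w := u)
    have h4 := hT.connected.dist_triangle (u := q) (v := p) (w := v)
    have h5 := hT.connected.dist_triangle (u := u) (v := v) (w := w)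
    have h6 := hT.dist_ne_of_adj u hw
    have h7 := hT.dist_ne_of_adj v hw
    have h8 := dist_eq_one_iff_adj.2 h
    have h9 := dist_eq_one_iff_adj.2 hpq
    have h10 := T.dist_comm (u := p) (v := q)
    have h11 := T.dist_comm (u := p) (v := u)
    have h12 := T.dist_comm (u := p) (v := v)
    have h13 := T.dist_comm (u := q) (v := u)
    have h14 := T.dist_comm (u := q) (v := v)
    -- If p ≠ v, both q and the neighbour w of p towards v are closer to u than p is, so they
    -- coincide; yet w is closer to v than p and q is farther.
    have hqw : w = q := by
      refine eq_of_mem_branch hT hw hpq (p := u) ?_ ?_ <;> rw [mem_branch] <;> omega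
    subst hqw
    omega

/-- The edges with an end vertex in a branch. -/
noncomputable def branchEdges (T : SimpleGraph V) (u v : V) : Finset (Sym2 V) :=
  T.edgeFinset.filter fun e => ∃ p ∈ e, p ∈ branch T u v

/-- The contribution of the edges with an end vertex in a branch to the Mostar index. -/
noncomputable def branchSum (T : SimpleGraph V) (u v : V) : ℤ :=
  ∑ e ∈ branchEdges T u v, psi T e

theorem mk_mem_branchEdges {u v p q : V} :
    s(p, q) ∈ branchEdges T u v ↔ T.Adj p q ∧ (p ∈ branch T u v ∨ q ∈ branch T u v) := by
  simp [branchEdges]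

theorem branchEdges_disjoint (hT : T.IsTree) {v w w' : V} (h : T.Adj v w) (h' : T.Adj v w')
    (hne : w ≠ w') : Disjoint (branchEdges T v w) (branchEdges T v w') := by
  refine Finset.disjoint_left.2 fun e => ?_
  induction e using Sym2.ind with
  | _ p q =>
    rw [mk_mem_branchEdges, mk_mem_branchEdges]
    have key : ∀ p q, T.Adj p q → p ∈ branch T v w → q ∈ branch T v w' → False := by
      intro p q hpq hp hq
      have hq' : q ∉ branch T v w := fun hq' => hne (eq_of_mem_branch hT h h' hq' hq)
      obtain ⟨-, rfl⟩ := eq_of_adj_of_mem_branch hT h hpq hp hq'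
      exact self_notMem_branch _ _ hq
    rintro ⟨hpq, hp | hp⟩ ⟨-, hq | hq⟩
    · exact hne (eq_of_mem_branch hT h h' hp hq)
    · exact key p q hpq hp hq
    · exact key q p hpq.symm hp hq
    · exact hne (eq_of_mem_branch hT h h' hp hq)

theorem pairwiseDisjoint_branchEdges (hT : T.IsTree) {v : V} {s : Finset V}
    (hs : s ⊆ T.neighborFinset v) : (s : Set V).PairwiseDisjoint (branchEdges T v) := by
  intro w hw w' hw' hne
  refine branchEdges_disjoint hT ?_ ?_ hne
  · simpa using hs hw
  · simpa using hs hw'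

theorem mostar_eq_sum_branchSum (hT : T.IsTree) (r : V) :
    mostar T = ∑ w ∈ T.neighborFinset r, branchSum T r w := by
  unfold mostar branchSum
  rw [← Finset.sum_biUnion (pairwiseDisjoint_branchEdges hT subset_rfl)]
  refine Finset.sum_congr ?_ fun _ _ => rfl
  ext e
  induction e using Sym2.ind with
  | _ p q =>
    simp only [mem_edgeFinset, mem_edgeSet, Finset.mem_biUnion, mem_neighborFinset,
      mk_mem_branchEdges]
    constructor
    · intro hpq
      by_cases hp : p = r
      · subst hp
        exact ⟨q, hpq, hpq, Or.inr (head_mem_branch hpq)⟩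
      · obtain ⟨w, hw, hpw⟩ := exists_mem_branch hT hp
        exact ⟨w, hw, hpq, Or.inl hpw⟩
    · rintro ⟨w, -, hpq, -⟩
      exact hpq

theorem branchSum_eq (hT : T.IsTree) {u v : V} (h : T.Adj u v) :
    branchSum T u v = psi T s(u, v) + ∑ w ∈ children T u v, branchSum T v w := by
  unfold branchSum
  have hmem : s(u, v) ∉ (children T u v).biUnion (branchEdges T v) := by
    simp only [Finset.mem_biUnion, mk_mem_branchEdges, mem_children, not_exists]
    rintro w ⟨⟨hwu, hw⟩, -, h1 | h1⟩
    · exact hwu (eq_of_mem_branch hT hw h.symm h1 (head_mem_branch h.symm))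
    · exact self_notMem_branch _ _ h1
  rw [← Finset.sum_biUnion (pairwiseDisjoint_branchEdges hT (children_subset u v)),
    ← Finset.sum_insert hmem]
  refine Finset.sum_congr ?_ fun _ _ => rfl
  have key : ∀ p q, T.Adj p q → p ∈ branch T u v →
      s(p, q) = s(u, v) ∨ ∃ w ∈ children T u v, s(p, q) ∈ branchEdges T v w := by
    intro p q hpq hp
    rcases (mem_branch_iff hT h p).1 hp with rfl | ⟨w, hw, hwu, hpw⟩
    · by_cases hqu : q = u
      · subst hqu
        exact Or.inl Sym2.eq_swap
      · exact Or.inr ⟨q, mem_children.2 ⟨hqu, hpq⟩,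
          mk_mem_branchEdges.2 ⟨hpq, Or.inr (head_mem_branch hpq)⟩⟩
    · exact Or.inr ⟨w, mem_children.2 ⟨hwu, hw⟩, mk_mem_branchEdges.2 ⟨hpq, Or.inl hpw⟩⟩
  ext e
  induction e using Sym2.ind with
  | _ p q =>
    rw [Finset.mem_insert, Finset.mem_biUnion]
    constructor
    · rw [mk_mem_branchEdges]
      rintro ⟨hpq, hp | hq⟩
      · exact key p q hpq hp
      · rw [Sym2.eq_swap]
        exact key q p hpq.symm hq
    · rintro (heq | ⟨w, hw, hpq⟩)
      · rw [heq, mk_mem_branchEdges]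
        exact ⟨h, Or.inr (head_mem_branch h)⟩
      · rw [mk_mem_branchEdges] at hpq ⊢
        have := (branch_ssubset hT h hw).1
        exact ⟨hpq.1, hpq.2.imp (fun x => this x) (fun x => this x)⟩

end Branches

/-! ### Weights: what is gained by merging branches. -/

/-- Four times the least number of incomparable pairs of vertices in a rooted tree with `N`
vertices none of which has exactly one child. -/
def defect (N : ℕ) : ℤ := ((N : ℤ) - 1) ^ 2 + if Even N then 3 else 0

/-- The contribution, up to a linear term, of a branch with `s` vertices, `N` of which do not have
degree two, to the lower bound for twice the Mostar index. -/
def weight (s N : ℕ) : ℤ := defect N - 2 * s * (s + 1)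

/-- Merging makes the st cross pairs comparable, which lowers the weight by 4st, while the defect
grows by at most 2ab + 2, attained when a and b are both odd. -/
theorem weight_add_le {a b s t : ℕ} (has : a ≤ s) (hbt : b ≤ t) :
    weight (s + t) (a + b) + 2 * ((s : ℤ) * t - 1) ≤ weight s a + weight t b := by
  have h1 : (a : ℤ) * b ≤ s * t := by exact_mod_cast Nat.mul_le_mul has hbt
  unfold weight defect
  push_cast
  by_cases h2 : Even a <;> by_cases h3 : Even b <;> simp only [Nat.even_add, h2, h3] <;>
    norm_num <;> nlinarith

/-- The extra 1 counts the common root. The defect grows by at most 2ab + 2a + 2b - 2; comparing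
this with 4st leaves the two slack terms, which make the equality case readable. -/
theorem weight_add_succ_le {a b s t : ℕ} :
    weight (s + t) (a + b + 1) + 4 * ((s : ℤ) * t - a * b) + 2 * (((a : ℤ) - 1) * (b - 1)) ≤
      weight s a + weight t b := by
  unfold weight defect
  push_cast
  by_cases h2 : Even a <;> by_cases h3 : Even b <;>
    simp [Nat.even_add, Nat.even_add_one, h2, h3] <;> nlinarith

section Forest

variable {ι : Type*} {X : Finset ι} {σ N : ι → ℕ}

/-- Branches are merged one at a time. Each step has slack 2(st - 1), so equality after a merge
forces s = t = 1, hence two single vertices in all. -/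
theorem forest_bound (hX : X.Nonempty) (h : ∀ i ∈ X, 1 ≤ N i ∧ N i ≤ σ i) :
    weight (∑ i ∈ X, σ i) (∑ i ∈ X, N i) ≤ ∑ i ∈ X, weight (σ i) (N i) ∧
      (∑ i ∈ X, weight (σ i) (N i) ≤ weight (∑ i ∈ X, σ i) (∑ i ∈ X, N i) →
        X.card = 1 ∨ X.card = 2 ∧ ∀ i ∈ X, σ i = 1) := by
  induction hX using Finset.Nonempty.cons_induction with
  | singleton i => simp
  | cons i X hi hX ih =>
    simp only [Finset.mem_cons, forall_eq_or_imp] at h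
    obtain ⟨⟨h1, h2⟩, h3⟩ := h
    obtain ⟨ih1, -⟩ := ih h3
    simp only [Finset.sum_cons, Finset.card_cons]
    have h4 : ∑ i ∈ X, N i ≤ ∑ i ∈ X, σ i := Finset.sum_le_sum fun i hi => (h3 i hi).2
    have h5 : X.card ≤ ∑ i ∈ X, N i := by
      rw [Finset.card_eq_sum_ones]
      exact Finset.sum_le_sum fun i hi => (h3 i hi).1
    have h6 := hX.card_pos
    have h7 := weight_add_le h2 h4
    have h8 : 1 ≤ σ i * ∑ i ∈ X, σ i := Nat.mul_pos (by omega) (by omega)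
    have h9 : (1 : ℤ) ≤ (σ i : ℤ) * ((∑ i ∈ X, σ i : ℕ) : ℤ) := by exact_mod_cast h8
    refine ⟨by linarith, fun heq => Or.inr ?_⟩
    have h10 : (σ i : ℤ) * ((∑ i ∈ X, σ i : ℕ) : ℤ) = 1 := by linarith
    have h11 : σ i * ∑ i ∈ X, σ i = 1 := by exact_mod_cast h10
    have h12 : σ i = 1 := Nat.dvd_one.1 ⟨_, h11.symm⟩
    have h13 : ∑ i ∈ X, σ i = 1 := by rwa [h12, one_mul] at h11
    have h14 : X.card = 1 := by omega
    refine ⟨by omega, ?_⟩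
    obtain ⟨j, rfl⟩ := Finset.card_eq_one.1 h14
    simpa using ⟨h12, h13⟩

/-- One branch is split off and the others are merged by `forest_bound`. Both slack terms of
`weight_add_succ_le` must vanish: neither part contains degree-two vertices, and one part has a
single special vertex. The three-leaf alternative arises when the merged part is itself two single
vertices. -/
theorem rooted_bound (hX : 2 ≤ X.card) (h : ∀ i ∈ X, 1 ≤ N i ∧ N i ≤ σ i) :
    weight (∑ i ∈ X, σ i) (∑ i ∈ X, N i + 1) ≤ ∑ i ∈ X, weight (σ i) (N i) ∧
      (∑ i ∈ X, weight (σ i) (N i) ≤ weight (∑ i ∈ X, σ i) (∑ i ∈ X, N i + 1) →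
        (∃ i j, i ≠ j ∧ X = {i, j} ∧ σ i = 1 ∧ σ j = N j) ∨ X.card = 3 ∧ ∀ i ∈ X, σ i = 1) := by
  obtain ⟨i, hi⟩ : X.Nonempty := Finset.card_pos.1 (by omega)
  obtain ⟨Y, hiY, rfl⟩ : ∃ Y, ∃ h : i ∉ Y, X = Finset.cons i Y h :=
    ⟨X.erase i, Finset.notMem_erase _ _, by simp [hi]⟩
  rw [Finset.card_cons] at hX ⊢
  have hY : Y.Nonempty := Finset.card_pos.1 (by omega)
  simp only [Finset.mem_cons, forall_eq_or_imp] at h ⊢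
  obtain ⟨⟨h1, h2⟩, h3⟩ := h
  obtain ⟨ih1, ih2⟩ := forest_bound hY h3
  simp only [Finset.sum_cons]
  have h4 : ∑ i ∈ Y, N i ≤ ∑ i ∈ Y, σ i := Finset.sum_le_sum fun i hi => (h3 i hi).2
  have h5 : Y.card ≤ ∑ i ∈ Y, N i := by
    rw [Finset.card_eq_sum_ones]
    exact Finset.sum_le_sum fun i hi => (h3 i hi).1
  have h6 := hY.card_pos
  have h7 := weight_add_succ_le (a := N i) (b := ∑ i ∈ Y, N i) (s := σ i) (t := ∑ i ∈ Y, σ i)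
  have h8 : (N i : ℤ) * ((∑ i ∈ Y, N i : ℕ) : ℤ) ≤ (σ i : ℤ) * ((∑ i ∈ Y, σ i : ℕ) : ℤ) := by
    exact_mod_cast Nat.mul_le_mul h2 h4
  have h9 : (0 : ℤ) ≤ ((N i : ℤ) - 1) * (((∑ i ∈ Y, N i : ℕ) : ℤ) - 1) :=
    mul_nonneg (by omega) (by omega)
  refine ⟨by linarith, fun heq => ?_⟩
  have h10 : (N i : ℤ) * ((∑ i ∈ Y, N i : ℕ) : ℤ) = (σ i : ℤ) * ((∑ i ∈ Y, σ i : ℕ) : ℤ) := by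
    linarith
  have h11 : ((N i : ℤ) - 1) * (((∑ i ∈ Y, N i : ℕ) : ℤ) - 1) = 0 := by linarith
  have h12 : N i * ∑ i ∈ Y, N i = σ i * ∑ i ∈ Y, σ i := by exact_mod_cast h10
  have h13 : σ i = N i ∧ ∑ i ∈ Y, σ i = ∑ i ∈ Y, N i := by
    constructor
    · by_contra hne
      have : N i < σ i := by omega
      exact absurd h12 (Nat.mul_lt_mul_of_lt_of_le this h4 (by omega)).ne
    · by_contra hne
      have : ∑ i ∈ Y, N i < ∑ i ∈ Y, σ i := by omega
      exact absurd h12 (Nat.mul_lt_mul_of_le_of_lt h2 this (by omega)).ne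
  have h14 : N i = 1 ∨ ∑ i ∈ Y, N i = 1 := by
    rcases mul_eq_zero.1 h11 with h | h
    · left; omega
    · right; omega
  have ih3 := ih2 (by linarith)
  rcases h14 with h14 | h14
  · rcases ih3 with h15 | ⟨h15, h16⟩
    · left
      obtain ⟨j, rfl⟩ := Finset.card_eq_one.1 h15
      refine ⟨i, j, by simpa using hiY, by simp, by omega, by simpa using h13.2⟩
    · right
      exact ⟨by omega, by omega, h16⟩
  · left
    have h15 : Y.card = 1 := by omega
    obtain ⟨j, rfl⟩ := Finset.card_eq_one.1 h15
    refine ⟨j, i, ?_, ?_, ?_, h13.1⟩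
    · rintro rfl
      simp at hiY
    · rw [Finset.cons_eq_insert, Finset.pair_comm]
    · have := h13.2
      simp only [Finset.sum_singleton] at this h14
      omega

end Forest

/-! ### Brooms, the shapes of extremal branches. -/

section Broom

variable {V : Type*} {T : SimpleGraph V}

/-- The position on the spine at which the pendent vertex with a given index is attached. -/
def foot (i : ℕ) : ℕ := if i = 1 then 2 else i

/-- `S` is covered by a path with `h` vertices ending in `v` and by pendent vertices, indexed by
`I`, attached to it. -/
def Broom (T : SimpleGraph V) (v : V) (S : Finset V) (h : ℕ) (I : Set ℕ) : Prop :=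
  ∃ spine pend : ℕ → V, spine h = v ∧ 1 ≤ h ∧ (∀ i ∈ I, foot i ≤ h) ∧
    (∀ i, 1 ≤ i → i < h → T.Adj (spine i) (spine (i + 1))) ∧
    (∀ i ∈ I, T.Adj (spine (foot i)) (pend i)) ∧
    ∀ p ∈ S, (∃ i, 1 ≤ i ∧ i ≤ h ∧ spine i = p) ∨ ∃ i ∈ I, pend i = p

/-- The indices of the pendent vertices of an extremal branch with `N` vertices not of degree
two. -/
def pendIndices (N : ℕ) : Set ℕ := Set.Icc (if Even N then 1 else 2) ((N + 1) / 2)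

theorem broom_singleton (v : V) : Broom T v {v} 1 (pendIndices 1) := by
  have h : pendIndices 1 = ∅ := by
    simp [pendIndices]
  rw [h]
  exact ⟨fun _ => v, fun _ => v, rfl, le_rfl, by simp, by intro i; omega, by simp,
    fun p hp => Or.inl ⟨1, le_rfl, le_rfl, (Finset.mem_singleton.1 hp).symm⟩⟩

theorem Broom.extend {v w : V} {S : Finset V} {h : ℕ} {I : Set ℕ} (hb : Broom T w S h I)
    (hvw : T.Adj v w) : Broom T v (insert v S) (h + 1) I := by
  obtain ⟨spine, pend, h1, h2, h3, h4, h5, h6⟩ := hb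
  refine ⟨fun i => if i = h + 1 then v else spine i, pend, by simp, by omega,
    fun i hi => (h3 i hi).trans (by omega), fun i hi hi' => ?_, fun i hi => ?_, fun p hp => ?_⟩
  · by_cases hih : i = h
    · subst hih
      simpa [h1] using hvw.symm
    · simpa [hih, hi'.ne] using h4 i hi (by omega)
  · have := h3 i hi
    simpa [show foot i ≠ h + 1 by omega] using h5 i hi
  · rcases Finset.mem_insert.1 hp with rfl | hp
    · exact Or.inl ⟨h + 1, by omega, le_rfl, by simp⟩
    · rcases h6 p hp with ⟨i, hi, hi', rfl⟩ | hi
      · exact Or.inl ⟨i, hi, by omega, by simp [show i ≠ h + 1 by omega]⟩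
      · exact Or.inr hi

theorem Broom.addPendent {v l : V} {S : Finset V} {h : ℕ} {I : Set ℕ} (hb : Broom T v S h I)
    (hh : 2 ≤ h) (hI : h ∉ I) (hl : T.Adj v l) : Broom T v (insert l S) h (insert h I) := by
  obtain ⟨spine, pend, h1, h2, h3, h4, h5, h6⟩ := hb
  have hf : foot h = h := by simp [foot]; omega
  refine ⟨spine, fun i => if i = h then l else pend i, h1, h2, ?_, h4, ?_, fun p hp => ?_⟩
  · rintro i (rfl | hi)
    · exact hf.le
    · exact h3 i hi
  · rintro i (rfl | hi)
    · simpa [hf, h1] using hl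
    · have : i ≠ h := by rintro rfl; exact hI hi
      simpa [this] using h5 i hi
  · rcases Finset.mem_insert.1 hp with rfl | hp
    · exact Or.inr ⟨h, Set.mem_insert _ _, by simp⟩
    · rcases h6 p hp with hi | ⟨i, hi, rfl⟩
      · exact Or.inl hi
      · have : i ≠ h := by rintro rfl; exact hI hi
        exact Or.inr ⟨i, Set.mem_insert_of_mem _ hi, by simp [this]⟩

theorem broom_star {v l₁ l₂ l₃ : V} (h₁ : T.Adj v l₁) (h₂ : T.Adj v l₂) (h₃ : T.Adj v l₃) :
    Broom T v {v, l₁, l₂, l₃} 2 (pendIndices 4) := by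
  have h : pendIndices 4 = {1, 2} := by
    ext i
    simp only [pendIndices, show Even 4 by decide, if_true, Set.mem_Icc, Set.mem_insert_iff,
      Set.mem_singleton_iff]
    omega
  rw [h]
  refine ⟨fun i => if i = 1 then l₁ else v, fun i => if i = 1 then l₂ else l₃, by simp, by simp,
    by simp [foot], fun i hi hi' => ?_, by simp [foot, h₂, h₃], fun p hp => ?_⟩
  · obtain rfl : i = 1 := by omega
    simpa using h₁.symm
  · simp only [Finset.mem_insert, Finset.mem_singleton] at hp
    rcases hp with rfl | rfl | rfl | rfl
    · exact Or.inl ⟨2, by simp⟩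
    · exact Or.inl ⟨1, by simp⟩
    · exact Or.inr ⟨1, by simp⟩
    · exact Or.inr ⟨2, by simp⟩

/-- A new branching vertex with its leaf adds two special vertices and keeps the parity, so only the
top index is new. -/
theorem pendIndices_add_two {N : ℕ} (hN : 1 ≤ N) :
    pendIndices (N + 2) = insert ((N + 1) / 2 + 1) (pendIndices N) := by
  ext i
  simp only [pendIndices, Nat.even_add, even_two, iff_true, Set.mem_Icc, Set.mem_insert_iff]
  split_ifs with h
  · omega
  · have : N % 2 = 1 := Nat.odd_iff.1 (Nat.not_even_iff_odd.1 h)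
    omega

end Broom

/-! ### The lower bound for a branch and its equality case. -/

section BranchBound

variable {V : Type*} [Fintype V] {T : SimpleGraph V}

/-- The first vertex not of degree two is either a leaf, giving one, or has at least two children,
giving at least three. -/
theorem special_pos_and_ne_two (hT : T.IsTree) {u v : V} (h : T.Adj u v) :
    1 ≤ special T u v ∧ special T u v ≠ 2 := by
  induction hk : (branch T u v).card using Nat.strong_induction_on generalizing u v with
  | _ k ih =>
    subst hk
    have ih' : ∀ w ∈ children T u v, 1 ≤ special T v w ∧ special T v w ≠ 2 := fun w hw =>
      ih _ (Finset.card_lt_card (branch_ssubset hT h hw)) (mem_children.1 hw).2 rfl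
    have h1 := children_card h
    have h2 := special_eq hT h
    have h3 : (children T u v).card ≤ ∑ w ∈ children T u v, special T v w := by
      rw [Finset.card_eq_sum_ones]
      exact Finset.sum_le_sum fun i hi => (ih' i hi).1
    split_ifs at h2 with h4
    · obtain ⟨w, hw⟩ := Finset.card_eq_one.1 (show (children T u v).card = 1 by omega)
      rw [hw, Finset.sum_singleton, zero_add] at h2
      rw [h2]
      exact ih' w (by simp [hw])
    · rcases Nat.eq_zero_or_pos (children T u v).card with h5 | h5
      · rw [Finset.card_eq_zero] at h5
        rw [h5, Finset.sum_empty] at h2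
        omega
      · omega

theorem special_le_card (hT : T.IsTree) {u v : V} (h : T.Adj u v) :
    1 ≤ special T u v ∧ special T u v ≤ (branch T u v).card :=
  ⟨(special_pos_and_ne_two hT h).1, special_le u v⟩

theorem branch_eq_singleton {u v : V} (h : T.Adj u v)
    (hc : (branch T u v).card = 1) : branch T u v = {v} := by
  obtain ⟨x, hx⟩ := Finset.card_eq_one.1 hc
  have := head_mem_branch h
  rw [hx, Finset.mem_singleton] at this
  rw [hx, this]

/-- The edge uv adds at least n - 2s, where s is the order of the branch; equality in the total
therefore passes to the sum over the children. -/
theorem branchSum_bound_of_children (hT : T.IsTree) {u v : V} (h : T.Adj u v) {P : Prop}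
    (hc : 2 * Fintype.card V * ((branch T u v).card - 1 : ℤ) +
        weight (branch T u v).card (special T u v) + 4 * (branch T u v).card ≤
          2 * ∑ w ∈ children T u v, branchSum T v w ∧
      (2 * ∑ w ∈ children T u v, branchSum T v w ≤
          2 * Fintype.card V * ((branch T u v).card - 1 : ℤ) +
            weight (branch T u v).card (special T u v) + 4 * (branch T u v).card → P)) :
    2 * Fintype.card V * (branch T u v).card + weight (branch T u v).card (special T u v) ≤
        2 * branchSum T u v ∧
      (2 * branchSum T u v ≤ 2 * Fintype.card V * (branch T u v).card +
          weight (branch T u v).card (special T u v) → P) := by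
  have habs := le_abs_self ((Fintype.card V : ℤ) - 2 * (branch T u v).card)
  rw [branchSum_eq hT h, psi_mk hT h]
  exact ⟨by linarith, fun hge => hc.2 (by linarith)⟩

/-- The edges inside a branch contribute least if the branch is a path that ends in a binary
caterpillar, possibly with one more pendent vertex at its last branch vertex. -/
theorem childSum_bound (hT : T.IsTree) {u v : V} (h : T.Adj u v) :
    2 * Fintype.card V * ((branch T u v).card - 1 : ℤ) +
        weight (branch T u v).card (special T u v) + 4 * (branch T u v).card ≤
          2 * ∑ w ∈ children T u v, branchSum T v w ∧
      (2 * ∑ w ∈ children T u v, branchSum T v w ≤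
          2 * Fintype.card V * ((branch T u v).card - 1 : ℤ) +
            weight (branch T u v).card (special T u v) + 4 * (branch T u v).card →
        Broom T v (branch T u v) ((branch T u v).card - special T u v / 2)
          (pendIndices (special T u v))) := by
  induction hk : (branch T u v).card using Nat.strong_induction_on generalizing u v with
  | _ k ih =>
    subst hk
    have ih' := fun w (hw : w ∈ children T u v) =>
      branchSum_bound_of_children hT (mem_children.1 hw).2
        (ih _ (Finset.card_lt_card (branch_ssubset hT h hw)) (mem_children.1 hw).2 rfl)
    have hsp : ∀ w ∈ children T u v,
        1 ≤ special T v w ∧ special T v w ≤ (branch T v w).card := fun w hw =>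
      special_le_card hT (mem_children.1 hw).2
    have hcard := card_branch_eq hT h
    have hspec := special_eq hT h
    have hdeg := children_card h
    set n : ℤ := (Fintype.card V : ℤ)
    set s := (branch T u v).card
    set N := special T u v
    have hle : ∑ w ∈ children T u v, (2 * n * (branch T v w).card +
        weight (branch T v w).card (special T v w)) ≤
        ∑ w ∈ children T u v, 2 * branchSum T v w := Finset.sum_le_sum fun w hw => (ih' w hw).1
    have heq_of : ∑ w ∈ children T u v, 2 * branchSum T v w ≤
        ∑ w ∈ children T u v, (2 * n * (branch T v w).card +
          weight (branch T v w).card (special T v w)) →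
        ∀ w ∈ children T u v, Broom T w (branch T v w)
          ((branch T v w).card - special T v w / 2) (pendIndices (special T v w)) := by
      intro hge w hw
      have := (Finset.sum_eq_sum_iff_of_le fun w hw => (ih' w hw).1).1 (le_antisymm hle hge) w hw
      exact (ih' w hw).2 this.ge
    have hlin : ∑ w ∈ children T u v, (2 * n * ((branch T v w).card : ℤ) +
        weight (branch T v w).card (special T v w)) = 2 * n * ((s : ℤ) - 1) +
        ∑ w ∈ children T u v, weight (branch T v w).card (special T v w) := by
      rw [Finset.sum_add_distrib, ← Finset.mul_sum, hcard]
      push_cast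
      ring
    rw [hlin, ← Finset.mul_sum] at hle heq_of
    have hX : (children T u v).card = 0 ∨ (children T u v).card = 1 ∨
        2 ≤ (children T u v).card := by omega
    rcases hX with hX | hX | hX
    · have hd : T.degree v ≠ 2 := by omega
      rw [Finset.card_eq_zero] at hX
      rw [hX, Finset.sum_empty] at hcard hspec
      rw [if_neg hd] at hspec
      have hs : s = 1 := by omega
      have hN : N = 1 := by omega
      constructor
      · simp [hX, hs, hN, weight, defect]
      · intro _
        rw [branch_eq_singleton h hs, hs, hN]
        exact broom_singleton v
    · have hd : T.degree v = 2 := by omega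
      obtain ⟨w, hw⟩ := Finset.card_eq_one.1 hX
      have hwc : w ∈ children T u v := by simp [hw]
      have hb := branch_eq hT h
      rw [hw, Finset.singleton_biUnion] at hb
      rw [hw, Finset.sum_singleton] at hcard hspec
      simp only [hw, Finset.sum_singleton] at hle heq_of
      rw [if_pos hd, zero_add] at hspec
      -- The 4s in the statement offsets the root: `weight s N + 4s` is the weight of the branch
      -- without its root. The same identity serves the branching case below.
      have hwt : weight s N = weight (branch T v w).card (special T v w) - 4 * s := by
        rw [hspec, hcard]
        unfold weight
        push_cast
        ring
      constructor
      · rw [hwt, hw, Finset.sum_singleton]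
        linarith
      · intro hge
        rw [hwt, hw, Finset.sum_singleton] at hge
        have := (heq_of (by linarith) w (by simp)).extend (mem_children.1 hwc).2
        have h1 := (hsp w hwc).2
        rw [hb, hspec, hcard,
          show 1 + (branch T v w).card - special T v w / 2 =
            (branch T v w).card - special T v w / 2 + 1 by omega]
        exact this
    · have hd : T.degree v ≠ 2 := by omega
      rw [if_neg hd, add_comm] at hspec
      obtain ⟨hf, hf'⟩ := rooted_bound hX hsp
      have hwt : weight s N = weight (∑ w ∈ children T u v, (branch T v w).card)
          (∑ w ∈ children T u v, special T v w + 1) - 4 * s := by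
        rw [hspec, hcard]
        unfold weight
        push_cast
        ring
      constructor
      · rw [hwt]
        linarith
      · intro hge
        rw [hwt] at hge
        have hb := heq_of (by linarith)
        rcases hf' (by linarith) with ⟨l, w, hlw, hc, hl, hw⟩ | ⟨hc, hl⟩
        · have hlc : l ∈ children T u v := by simp [hc]
          have hwc : w ∈ children T u v := by simp [hc]
          rw [hc, Finset.sum_pair hlw] at hcard hspec
          have h1 := hsp l hlc
          have h2 := hsp w hwc
          have hN : N = special T v w + 2 := by omega
          have hs : s = special T v w + 2 := by omega
          have hbr := (hb w hwc).extend (mem_children.1 hwc).2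
          -- The branch at w has no degree-two vertices, so its spine has exactly this length; after
          -- adding v the leaf l hangs at the last spine position, one above all old pendent
          -- indices.
          have hh : (branch T v w).card - special T v w / 2 = (special T v w + 1) / 2 := by omega
          rw [hh] at hbr
          have hbr' := hbr.addPendent (by omega) (by
            rintro ⟨-, h⟩
            omega) (mem_children.1 hlc).2
          rw [branch_eq hT h, hc, Finset.biUnion_insert, Finset.singleton_biUnion, hs, hN,
            branch_eq_singleton (mem_children.1 hlc).2 hl, pendIndices_add_two h2.1,
            show special T v w + 2 - (special T v w + 2) / 2 = (special T v w + 1) / 2 + 1 by omega,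
            Finset.singleton_union, Finset.insert_comm]
          exact hbr'
        · obtain ⟨x, y, z, hxy, hxz, hyz, hc'⟩ := Finset.card_eq_three.1 hc
          have hx : x ∈ children T u v := by simp [hc']
          have hy : y ∈ children T u v := by simp [hc']
          have hz : z ∈ children T u v := by simp [hc']
          have h1 : ∑ w ∈ children T u v, (branch T v w).card = 3 := by
            rw [Finset.sum_congr rfl hl, Finset.sum_const, hc]
            rfl
          have h2 : ∑ w ∈ children T u v, special T v w = 3 := by
            rw [Finset.sum_congr rfl fun w hw => le_antisymm ((hsp w hw).2.trans (hl w hw).le)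
              (hsp w hw).1, Finset.sum_const, hc]
            rfl
          have hN : N = 4 := by omega
          have hs : s = 4 := by omega
          have := broom_star (mem_children.1 hx).2 (mem_children.1 hy).2 (mem_children.1 hz).2
          rw [branch_eq hT h, hc', Finset.biUnion_insert, Finset.biUnion_insert,
            Finset.singleton_biUnion, hs, hN,
            branch_eq_singleton (mem_children.1 hx).2 (hl x hx),
            branch_eq_singleton (mem_children.1 hy).2 (hl y hy),
            branch_eq_singleton (mem_children.1 hz).2 (hl z hz)]
          exact this

theorem branchSum_bound (hT : T.IsTree) {u v : V} (h : T.Adj u v) :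
    2 * Fintype.card V * (branch T u v).card + weight (branch T u v).card (special T u v) ≤
        2 * branchSum T u v ∧
      (2 * branchSum T u v ≤ 2 * Fintype.card V * (branch T u v).card +
          weight (branch T u v).card (special T u v) →
        Broom T v (branch T u v) ((branch T u v).card - special T u v / 2)
          (pendIndices (special T u v))) :=
  branchSum_bound_of_children hT h (childSum_bound hT h)

end BranchBound

/-- Twice the Mostar index of the path with `n` vertices. -/
def base (n : ℕ) : ℤ := ((n : ℤ) - 1) ^ 2 - if Even n then 1 else 0

/-- Both numbers are at most n/2 and they add up to n - 1, so they differ by at most one. -/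
theorem base_eq {n s t : ℕ} (h : s + t + 1 = n) (hs : 2 * s ≤ n) (ht : 2 * t ≤ n) :
    2 * (n : ℤ) * (n - 1) - 2 * s * (s + 1) - 2 * t * (t + 1) = base n := by
  unfold base
  have h1 : s = t ∨ s = t + 1 ∨ t = s + 1 := by omega
  rcases h1 with rfl | rfl | rfl
  · rw [if_neg (by rw [Nat.not_even_iff_odd]; exact ⟨s, by omega⟩), ← h]
    push_cast
    ring
  · rw [if_pos ⟨t + 1, by omega⟩, ← h]
    push_cast
    ring
  · rw [if_pos ⟨s + 1, by omega⟩, ← h]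
    push_cast
    ring

/-! ### Three groups of similar sizes are strictly worse. -/

section ThreeGroups

/-- The right side is the left side at uᵢ = sᵢ - 1, so the claim is that this corner of the box is
the maximum. The left side is 4u₁u₂ + 8(u₁ + u₂) + 4 minus a square. If u₁ + u₂ ≥ s₃ - 3, the square
is least at u₃ = s₃ - 1, and then raising u₁ and u₂ to their limits helps (`main`). Otherwise u₁ and
u₂ are first raised until u₁ + u₂ = s₃ - 3, where the square in `main` vanishes. -/
theorem quad_le {s₁ s₂ s₃ u₁ u₂ u₃ : ℤ} (h1 : s₁ ≤ s₃) (h2 : s₂ ≤ s₃) (h3 : s₃ + 2 ≤ s₁ + s₂)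
    (hu1 : 0 ≤ u₁) (hu2 : 0 ≤ u₂) (hv1 : u₁ ≤ s₁ - 1) (hv2 : u₂ ≤ s₂ - 1)
    (hv3 : u₃ ≤ s₃ - 1) :
    (u₁ + u₂ + u₃) ^ 2 - 2 * (u₁ ^ 2 + u₂ ^ 2 + u₃ ^ 2) + 4 * (u₁ + u₂ + u₃) ≤
      (s₁ + s₂ + s₃) ^ 2 - 2 * (s₁ ^ 2 + s₂ ^ 2 + s₃ ^ 2) + 2 * (s₁ + s₂ + s₃) - 9 := by
  have main : ∀ x y : ℤ, 0 ≤ x → 0 ≤ y → x ≤ s₁ - 1 → y ≤ s₂ - 1 → s₃ - 3 ≤ x + y →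
      4 * x * y + 8 * (x + y) + 4 - (x + y - s₃ + 3) ^ 2 ≤
      (s₁ + s₂ + s₃) ^ 2 - 2 * (s₁ ^ 2 + s₂ ^ 2 + s₃ ^ 2) + 2 * (s₁ + s₂ + s₃) - 9 := by
    intro x y hx hy hx1 hy1 hxy
    have e1 : 0 ≤ (s₁ - 1 - x) * (2 * y + 2 * s₃ + 3 - s₁ - x) :=
      mul_nonneg (by linarith) (by linarith)
    have e2 : 0 ≤ (s₂ - 1 - y) * (2 * (s₁ - 1) + 2 * s₃ + 3 - s₂ - y) :=
      mul_nonneg (by linarith) (by linarith)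
    linarith
  have split : (u₁ + u₂ + u₃) ^ 2 - 2 * (u₁ ^ 2 + u₂ ^ 2 + u₃ ^ 2) + 4 * (u₁ + u₂ + u₃) =
      4 * u₁ * u₂ + 8 * (u₁ + u₂) + 4 - (u₁ + u₂ - u₃ + 2) ^ 2 := by ring
  rw [split]
  by_cases hxy : s₃ - 3 ≤ u₁ + u₂
  · have h4 := main u₁ u₂ hu1 hu2 hv1 hv2 hxy
    have h5 : (u₁ + u₂ - s₃ + 3) ^ 2 ≤ (u₁ + u₂ - u₃ + 2) ^ 2 :=
      pow_le_pow_left₀ (by linarith) (by linarith) 2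
    linarith
  · obtain ⟨x, y, hx, hy, hx1, hy1, hxy'⟩ : ∃ x y : ℤ, u₁ ≤ x ∧ u₂ ≤ y ∧ x ≤ s₁ - 1 ∧
        y ≤ s₂ - 1 ∧ x + y = s₃ - 3 := by
      by_cases h : s₃ - 3 - u₂ ≤ s₁ - 1
      · exact ⟨s₃ - 3 - u₂, u₂, by linarith, le_rfl, h, hv2, by ring⟩
      · exact ⟨s₁ - 1, s₃ - 3 - (s₁ - 1), hv1, by linarith, le_rfl, by linarith, by ring⟩
    have h4 := main x y (by linarith) (by linarith) hx1 hy1 hxy'.ge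
    have h5 : u₁ * u₂ ≤ x * y := mul_le_mul hx hy hu2 (by linarith)
    have h6 : x + y - s₃ + 3 = 0 := by linarith
    rw [h6] at h4
    linarith [sq_nonneg (u₁ + u₂ - u₃ + 2)]

/-- In the variables s₂ + s₃ - s₁ and its rotations the right side is the sum of pairwise products,
and each variable is at least 2. The variables have equal parity, so excluding (2, 2, 2) raises
their sum by at least 2. -/
theorem heron_pos {s₁ s₂ s₃ : ℤ} (h1 : s₁ + 2 ≤ s₂ + s₃) (h2 : s₂ + 2 ≤ s₁ + s₃)
    (h3 : s₃ + 2 ≤ s₁ + s₂) (hne : ¬ (s₁ = 2 ∧ s₂ = 2 ∧ s₃ = 2)) :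
    2 * (s₁ + s₂ + s₃) + 2 < (s₁ + s₂ + s₃) ^ 2 - 2 * (s₁ ^ 2 + s₂ ^ 2 + s₃ ^ 2) := by
  obtain ⟨a, ha⟩ : ∃ a, s₂ + s₃ - s₁ - 2 = a := ⟨_, rfl⟩
  obtain ⟨b, hb⟩ : ∃ b, s₁ + s₃ - s₂ - 2 = b := ⟨_, rfl⟩
  obtain ⟨c, hc⟩ : ∃ c, s₁ + s₂ - s₃ - 2 = c := ⟨_, rfl⟩
  have ha0 : 0 ≤ a := by linarith
  have hb0 : 0 ≤ b := by linarith
  have hc0 : 0 ≤ c := by linarith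
  have hsum : 2 ≤ a + b + c := by omega
  have key : (s₁ + s₂ + s₃) ^ 2 - 2 * (s₁ ^ 2 + s₂ ^ 2 + s₃ ^ 2) =
      (a + 2) * (b + 2) + (b + 2) * (c + 2) + (c + 2) * (a + 2) := by
    rw [← ha, ← hb, ← hc]
    ring
  have hs : s₁ + s₂ + s₃ = a + b + c + 6 := by linarith
  rw [key, hs]
  nlinarith [mul_nonneg ha0 hb0, mul_nonneg hb0 hc0, mul_nonneg hc0 ha0]

/-- With S = n - 1, the excess over `base n` is at least S² - 2∑sᵢ² + ∑(Nᵢ - 1)². Adding `quad_le`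
and `heron_pos` gives the first claim; `heron_pos` alone gives the second. -/
theorem three_groups {n s₁ s₂ s₃ N₁ N₂ N₃ : ℕ} (hn : s₁ + s₂ + s₃ + 1 = n)
    (h12 : n < 2 * (s₁ + s₂)) (h13 : n < 2 * (s₁ + s₃)) (h23 : n < 2 * (s₂ + s₃))
    (hN1 : 1 ≤ N₁ ∧ N₁ ≤ s₁) (hN2 : 1 ≤ N₂ ∧ N₂ ≤ s₂) (hN3 : 1 ≤ N₃ ∧ N₃ ≤ s₃) :
    ((N₁ + N₂ + N₃ + 1 : ℤ) - 2) ^ 2 + 7 < 2 * (2 * (n : ℤ) * (n - 1) +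
        (weight s₁ N₁ + weight s₂ N₂ + weight s₃ N₃) - base n) ∧
      (N₁ + N₂ + N₃ + 1 = 5 → 12 < 2 * (n : ℤ) * (n - 1) +
        (weight s₁ N₁ + weight s₂ N₂ + weight s₃ N₃) - base n) := by
  -- For (2, 2, 2) `heron_pos` fails, as 12 < 14; the values of Nᵢ are checked one by one.
  by_cases hs : s₁ = 2 ∧ s₂ = 2 ∧ s₃ = 2
  · obtain ⟨rfl, rfl, rfl⟩ := hs
    obtain rfl : n = 7 := by omega
    obtain ⟨a1, b1⟩ := hN1
    obtain ⟨a2, b2⟩ := hN2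
    obtain ⟨a3, b3⟩ := hN3
    have e7 : ¬ Even 7 := by decide
    interval_cases N₁ <;> interval_cases N₂ <;> interval_cases N₃ <;>
      norm_num [weight, defect, base, e7]
  · have hpos := heron_pos (s₁ := s₁) (s₂ := s₂) (s₃ := s₃) (by omega) (by omega) (by omega)
      (by omega)
    have hq : ((N₁ - 1 : ℤ) + (N₂ - 1) + (N₃ - 1)) ^ 2 -
        2 * ((N₁ - 1 : ℤ) ^ 2 + (N₂ - 1) ^ 2 + (N₃ - 1) ^ 2) +
        4 * ((N₁ - 1 : ℤ) + (N₂ - 1) + (N₃ - 1)) ≤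
        ((s₁ : ℤ) + s₂ + s₃) ^ 2 - 2 * ((s₁ : ℤ) ^ 2 + s₂ ^ 2 + s₃ ^ 2) +
        2 * (s₁ + s₂ + s₃) - 9 := by
      rcases le_total s₁ s₂ with h | h
      · rcases le_total s₂ s₃ with h' | h'
        · exact quad_le (by omega) (by omega) (by omega) (by omega) (by omega) (by omega)
            (by omega) (by omega)
        · have := quad_le (s₁ := s₁) (s₂ := s₃) (s₃ := s₂) (u₁ := N₁ - 1) (u₂ := N₃ - 1)
            (u₃ := N₂ - 1) (by omega) (by omega) (by omega) (by omega) (by omega) (by omega)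
            (by omega) (by omega)
          linarith
      · rcases le_total s₁ s₃ with h' | h'
        · exact quad_le (by omega) (by omega) (by omega) (by omega) (by omega) (by omega)
            (by omega) (by omega)
        · have := quad_le (s₁ := s₂) (s₂ := s₃) (s₃ := s₁) (u₁ := N₂ - 1) (u₂ := N₃ - 1)
            (u₃ := N₁ - 1) (by omega) (by omega) (by omega) (by omega) (by omega) (by omega)
            (by omega) (by omega)
          linarith
    have hd : ∀ N : ℕ, ((N : ℤ) - 1) ^ 2 ≤ defect N := by
      intro N
      unfold defect
      split_ifs <;> linarith
    have hb : base n ≤ ((n : ℤ) - 1) ^ 2 := by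
      unfold base
      split_ifs <;> linarith
    have d1 := hd N₁
    have d2 := hd N₂
    have d3 := hd N₃
    have hn' : (n : ℤ) = s₁ + s₂ + s₃ + 1 := by exact_mod_cast hn.symm
    rw [hn'] at hb ⊢
    unfold weight
    refine ⟨by nlinarith, fun hN => ?_⟩
    have h7 : (6 : ℤ) ≤ (s₁ : ℤ) + s₂ + s₃ := by omega
    nlinarith [sq_nonneg ((N₁ : ℤ) - 1), sq_nonneg ((N₂ : ℤ) - 1), sq_nonneg ((N₃ : ℤ) - 1)]

end ThreeGroups

/-- Numbers that are at most `n / 2` and add up to `n - 1` can be divided into two groups with sums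
at most `n / 2`, or into three groups any two of which have a sum larger than `n / 2`. -/
theorem exists_groups {ι : Type*} {X : Finset ι} {σ : ι → ℕ} {n : ℕ}
    (hsum : ∑ i ∈ X, σ i + 1 = n) (hle : ∀ i ∈ X, 2 * σ i ≤ n) :
    (∃ Y Z, Disjoint Y Z ∧ Y ∪ Z = X ∧ 2 * ∑ i ∈ Y, σ i ≤ n ∧ 2 * ∑ i ∈ Z, σ i ≤ n) ∨
      ∃ Y Z W, Disjoint Y Z ∧ Disjoint (Y ∪ Z) W ∧ Y ∪ Z ∪ W = X ∧
        n < 2 * (∑ i ∈ Y, σ i + ∑ i ∈ Z, σ i) ∧ n < 2 * (∑ i ∈ Y, σ i + ∑ i ∈ W, σ i) ∧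
        n < 2 * (∑ i ∈ Z, σ i + ∑ i ∈ W, σ i) := by
  -- Y is a subset of maximal sum not exceeding n/2. If its complement is too heavy, any c of
  -- nonzero size in the complement gives the groups Y, {c} and the rest.
  obtain ⟨Y, hY, hmax⟩ := Finset.exists_max_image
    (X.powerset.filter fun Y => 2 * ∑ i ∈ Y, σ i ≤ n) (fun Y => ∑ i ∈ Y, σ i)
    ⟨∅, by simp⟩
  rw [Finset.mem_filter, Finset.mem_powerset] at hY
  obtain ⟨hYX, hYn⟩ := hY
  have hsplit := Finset.sum_sdiff (f := σ) hYX
  by_cases hZ : 2 * ∑ i ∈ X \ Y, σ i ≤ n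
  · exact Or.inl ⟨Y, X \ Y, Finset.disjoint_sdiff, Finset.union_sdiff_of_subset hYX, hYn, hZ⟩
  · right
    obtain ⟨c, hc, hc0⟩ : ∃ c ∈ X \ Y, σ c ≠ 0 := by
      by_contra hcon
      push Not at hcon
      rw [Finset.sum_eq_zero hcon] at hZ
      omega
    have hcX := (Finset.mem_sdiff.1 hc).1
    have hcY := (Finset.mem_sdiff.1 hc).2
    have hrest := Finset.add_sum_erase (X \ Y) σ hc
    have h1 : n < 2 * (∑ i ∈ Y, σ i + σ c) := by
      by_contra hcon
      have hins : ∑ i ∈ insert c Y, σ i = ∑ i ∈ Y, σ i + σ c := by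
        rw [Finset.sum_insert hcY, add_comm]
      have := hmax (insert c Y) (by
        rw [Finset.mem_filter, Finset.mem_powerset, hins]
        exact ⟨Finset.insert_subset hcX hYX, not_lt.1 hcon⟩)
      simp only [hins] at this
      omega
    -- The singleton {c} competes with Y, so Y is at least as heavy; hence Y and the rest outweigh c
    -- and the rest, which exceed n/2.
    have h2 : σ c ≤ ∑ i ∈ Y, σ i := by
      have := hmax {c} (by simpa using ⟨hcX, hle c hcX⟩)
      simpa using this
    refine ⟨Y, {c}, (X \ Y).erase c, by simpa using hcY, ?_, ?_, ?_, ?_, ?_⟩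
    · rw [Finset.disjoint_left]
      intro i hi hi'
      simp only [Finset.mem_union, Finset.mem_singleton, Finset.mem_erase,
        Finset.mem_sdiff] at hi hi'
      tauto
    · ext i
      have : i ∈ Y → i ∈ X := fun h => hYX h
      have : i = c → i ∈ X := fun h => h ▸ hcX
      simp only [Finset.mem_union, Finset.mem_singleton, Finset.mem_erase, Finset.mem_sdiff]
      tauto
    · simpa using h1
    · omega
    · rw [Finset.sum_singleton]
      omega

/-! ### Lower bounds for the Mostar index at a centroid. -/

section LowerBound

variable {V : Type*} [Fintype V] {T : SimpleGraph V}

/-- Otherwise one could keep moving into the branch with more than half of the vertices; it never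
leads back, since the two sides of an edge add up to n, so the branches would shrink forever. -/
theorem exists_centroid (hT : T.IsTree) :
    ∃ r, ∀ w, T.Adj r w → 2 * (branch T r w).card ≤ Fintype.card V := by
  by_contra hcon
  push Not at hcon
  have key : ∀ k u v, T.Adj u v → (branch T u v).card = k →
      Fintype.card V < 2 * (branch T u v).card → False := by
    intro k
    induction k using Nat.strong_induction_on with
    | _ k ih =>
      intro u v h hk hlt
      obtain ⟨w, hw, hwlt⟩ := hcon v
      have hwu : w ≠ u := by
        rintro rfl
        have := card_branch_add hT h
        omega
      refine ih _ ?_ v w hw rfl hwlt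
      rw [← hk]
      exact Finset.card_lt_card (branch_ssubset hT h (mem_children.2 ⟨hwu, hw⟩))
  obtain ⟨r⟩ := hT.connected.nonempty
  obtain ⟨w, hw, hlt⟩ := hcon r
  exact key _ r w hw rfl hlt

/-- The number of vertices that do not have degree two. -/
noncomputable def specialCount (T : SimpleGraph V) : ℕ :=
  (Finset.univ.filter fun w => T.degree w ≠ 2).card

/-- The edge ra is charged to the side of a only. The side of r enters without its root edge, thus
with t = order - 1, which yields s + t + 1 = n as `base_eq` requires. -/
theorem mostar_bound_of_edge (hT : T.IsTree) {r a : V} (h : T.Adj r a)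
    (h1 : 2 * (branch T r a).card ≤ Fintype.card V)
    (h2 : Fintype.card V ≤ 2 * (branch T r a).card + 2) :
    base (Fintype.card V) + defect (special T r a) + defect (special T a r) ≤ 2 * mostar T ∧
      (2 * mostar T ≤
          base (Fintype.card V) + defect (special T r a) + defect (special T a r) →
        Broom T a (branch T r a) ((branch T r a).card - special T r a / 2)
          (pendIndices (special T r a)) ∧
        Broom T r (branch T a r) ((branch T a r).card - special T a r / 2)
          (pendIndices (special T a r))) := by
  have hcard := card_branch_add hT h
  obtain ⟨b1, e1⟩ := branchSum_bound hT h
  obtain ⟨b2, e2⟩ := childSum_bound hT h.symm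
  have hmo : mostar T = branchSum T r a + ∑ w ∈ children T a r, branchSum T r w := by
    rw [mostar_eq_sum_branchSum hT r, children, Finset.add_sum_erase]
    simpa using h
  have hpos : 0 < (branch T a r).card := Finset.card_pos.2 ⟨r, head_mem_branch h.symm⟩
  obtain ⟨t, ht⟩ : ∃ t, (branch T a r).card = t + 1 := ⟨_, (Nat.succ_pred_eq_of_pos hpos).symm⟩
  have hb := base_eq (n := Fintype.card V) (s := (branch T r a).card) (t := t) (by omega) h1
    (by omega)
  have hcardZ : ((branch T r a).card : ℤ) + (branch T a r).card = Fintype.card V := by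
    exact_mod_cast hcard
  have ht' : ((branch T a r).card : ℤ) = t + 1 := by exact_mod_cast ht
  have hid : 2 * (Fintype.card V : ℤ) * (branch T r a).card +
      weight (branch T r a).card (special T r a) +
      (2 * (Fintype.card V : ℤ) * ((branch T a r).card - 1 : ℤ) +
        weight (branch T a r).card (special T a r) + 4 * (branch T a r).card) =
      base (Fintype.card V) + defect (special T r a) + defect (special T a r) := by
    rw [← hb]
    unfold weight
    rw [ht'] at hcardZ ⊢
    rw [← hcardZ]
    ring
  rw [hmo]
  exact ⟨by linarith, fun hge => ⟨e1 (by linarith), e2 (by linarith)⟩⟩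

theorem weight_sum_le_mostar (hT : T.IsTree) (r : V) :
    2 * (Fintype.card V : ℤ) * (Fintype.card V - 1) +
      ∑ w ∈ T.neighborFinset r, weight (branch T r w).card (special T r w) ≤ 2 * mostar T := by
  have h1 : ∑ w ∈ T.neighborFinset r, (2 * (Fintype.card V : ℤ) * (branch T r w).card +
      weight (branch T r w).card (special T r w)) ≤
      ∑ w ∈ T.neighborFinset r, 2 * branchSum T r w :=
    Finset.sum_le_sum fun w hw => (branchSum_bound hT (by simpa using hw)).1
  have h2 := card_eq_sum_branch hT r
  have h3 : (Fintype.card V : ℤ) - 1 = ∑ w ∈ T.neighborFinset r, ((branch T r w).card : ℤ) := by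
    rw [← Nat.cast_sum]
    omega
  rw [Finset.sum_add_distrib, ← Finset.mul_sum, ← h3, ← Finset.mul_sum,
    ← mostar_eq_sum_branchSum hT r] at h1
  exact h1

/-- The three possibilities for the branches at a centroid: one of them contains about half of the
vertices, or they can be divided into two balanced groups with at least two branches each, or into
three groups of similar sizes. -/
theorem mostar_trichotomy (hT : T.IsTree) (hn : 4 ≤ Fintype.card V) :
    (∃ r a, T.Adj r a ∧ 2 * (branch T r a).card ≤ Fintype.card V ∧
      Fintype.card V ≤ 2 * (branch T r a).card + 2) ∨
    (∃ r Y Z, Disjoint Y Z ∧ Y ∪ Z = T.neighborFinset r ∧ 2 ≤ Y.card ∧ 2 ≤ Z.card ∧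
      2 * ∑ w ∈ Y, (branch T r w).card ≤ Fintype.card V ∧
      2 * ∑ w ∈ Z, (branch T r w).card ≤ Fintype.card V) ∨
    (7 ≤ Fintype.card V ∧
      ((specialCount T : ℤ) - 2) ^ 2 + 7 < 2 * (2 * mostar T - base (Fintype.card V)) ∧
      (specialCount T = 5 → 12 < 2 * mostar T - base (Fintype.card V))) := by
  obtain ⟨r, hr⟩ := exists_centroid hT
  have hsum := card_eq_sum_branch hT r
  have hsum' : ∑ w ∈ T.neighborFinset r, (branch T r w).card + 1 = Fintype.card V := by omega
  rcases exists_groups hsum' (fun w hw => hr w (by simpa using hw)) with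
    ⟨Y, Z, hd, hu, hY, hZ⟩ | ⟨Y, Z, W, hd, hd', hu, h12, h13, h23⟩
  · have hYZ : ∑ w ∈ Y, (branch T r w).card + ∑ w ∈ Z, (branch T r w).card + 1 =
        Fintype.card V := by
      rw [← Finset.sum_union hd, hu, hsum']
    have single : ∀ Y Z : Finset V, Y ∪ Z = T.neighborFinset r →
        ∑ w ∈ Y, (branch T r w).card + ∑ w ∈ Z, (branch T r w).card + 1 = Fintype.card V →
        2 * ∑ w ∈ Y, (branch T r w).card ≤ Fintype.card V →
        2 * ∑ w ∈ Z, (branch T r w).card ≤ Fintype.card V → Y.card < 2 →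
        ∃ r a, T.Adj r a ∧ 2 * (branch T r a).card ≤ Fintype.card V ∧
          Fintype.card V ≤ 2 * (branch T r a).card + 2 := by
      intro Y Z hu hYZ hY hZ hc
      have hY1 : Y.card = 1 := by
        rcases Nat.eq_zero_or_pos Y.card with h0 | h0
        · rw [Finset.card_eq_zero] at h0
          rw [h0, Finset.sum_empty] at hYZ
          omega
        · omega
      obtain ⟨a, rfl⟩ := Finset.card_eq_one.1 hY1
      rw [Finset.sum_singleton] at hYZ hY
      refine ⟨r, a, ?_, hY, by omega⟩
      rw [← mem_neighborFinset, ← hu]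
      simp
    by_cases hYc : Y.card < 2
    · exact Or.inl (single Y Z hu hYZ hY hZ hYc)
    · by_cases hZc : Z.card < 2
      · exact Or.inl (single Z Y (by rw [Finset.union_comm, hu]) (by omega) hZ hY hZc)
      · exact Or.inr (Or.inl ⟨r, Y, Z, hd, hu, by omega, by omega, hY, hZ⟩)
  · right; right
    have hsumU : ∀ f : V → ℕ, ∑ w ∈ T.neighborFinset r, f w =
        ∑ w ∈ Y, f w + ∑ w ∈ Z, f w + ∑ w ∈ W, f w := by
      intro f
      rw [← hu, Finset.sum_union hd', Finset.sum_union hd]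
    have hsumW : ∑ w ∈ T.neighborFinset r, weight (branch T r w).card (special T r w) =
        ∑ w ∈ Y, weight (branch T r w).card (special T r w) +
        ∑ w ∈ Z, weight (branch T r w).card (special T r w) +
        ∑ w ∈ W, weight (branch T r w).card (special T r w) := by
      rw [← hu, Finset.sum_union hd', Finset.sum_union hd]
    have hsub : ∀ w, w ∈ Y ∨ w ∈ Z ∨ w ∈ W → T.Adj r w := by
      intro w hw
      rw [← mem_neighborFinset, ← hu]
      simp only [Finset.mem_union]
      tauto
    rw [hsumU] at hsum'
    have group : ∀ X : Finset V, (∀ w ∈ X, T.Adj r w) → 0 < ∑ w ∈ X, (branch T r w).card →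
        weight (∑ w ∈ X, (branch T r w).card) (∑ w ∈ X, special T r w) ≤
          ∑ w ∈ X, weight (branch T r w).card (special T r w) ∧
        1 ≤ ∑ w ∈ X, special T r w ∧
        ∑ w ∈ X, special T r w ≤ ∑ w ∈ X, (branch T r w).card ∧ 1 ≤ X.card := by
      intro X hX hpos
      have hne : X.Nonempty := by
        rw [Finset.nonempty_iff_ne_empty]
        rintro rfl
        simp at hpos
      have hsp : ∀ w ∈ X, 1 ≤ special T r w ∧ special T r w ≤ (branch T r w).card :=
        fun w hw => special_le_card hT (hX w hw)
      refine ⟨(forest_bound hne hsp).1, ?_, Finset.sum_le_sum fun w hw => (hsp w hw).2,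
        hne.card_pos⟩
      obtain ⟨w, hw⟩ := hne
      exact (hsp w hw).1.trans (Finset.single_le_sum (f := special T r) (by simp) hw)
    obtain ⟨gY, gY1, gY2, gY3⟩ := group Y (fun w hw => hsub w (Or.inl hw)) (by omega)
    obtain ⟨gZ, gZ1, gZ2, gZ3⟩ := group Z (fun w hw => hsub w (Or.inr (Or.inl hw))) (by omega)
    obtain ⟨gW, gW1, gW2, gW3⟩ := group W (fun w hw => hsub w (Or.inr (Or.inr hw))) (by omega)
    obtain ⟨t1, t2⟩ := three_groups hsum' h12 h13 h23 ⟨gY1, gY2⟩ ⟨gZ1, gZ2⟩ ⟨gW1, gW2⟩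
    have hdeg : T.degree r ≠ 2 := by
      rw [← card_neighborFinset_eq_degree, ← hu, Finset.card_union_of_disjoint hd',
        Finset.card_union_of_disjoint hd]
      omega
    have hK : specialCount T = ∑ w ∈ Y, special T r w + ∑ w ∈ Z, special T r w +
        ∑ w ∈ W, special T r w + 1 := by
      rw [specialCount, card_special_eq_sum hT r, if_neg hdeg, hsumU, add_comm]
    have hmo := weight_sum_le_mostar hT r
    rw [hsumW] at hmo
    refine ⟨by omega, ?_, ?_⟩
    · rw [hK]
      push_cast
      push_cast at t1
      linarith
    · intro hK5
      have := t2 (by omega)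
      linarith

/-- The centroid is counted as root of the group Z, while Y is treated as a forest. Since Y has at
least two branches, equality in `forest_bound` leaves only two single vertices. -/
theorem mostar_bound_of_two_groups (hT : T.IsTree) {r : V} {Y Z : Finset V} (hd : Disjoint Y Z)
    (hu : Y ∪ Z = T.neighborFinset r) (hY : 2 ≤ Y.card) (hZ : 2 ≤ Z.card)
    (hYn : 2 * ∑ w ∈ Y, (branch T r w).card ≤ Fintype.card V)
    (hZn : 2 * ∑ w ∈ Z, (branch T r w).card ≤ Fintype.card V) :
    specialCount T = ∑ w ∈ Y, special T r w + (∑ w ∈ Z, special T r w + 1) ∧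
    base (Fintype.card V) + defect (∑ w ∈ Y, special T r w) +
        defect (∑ w ∈ Z, special T r w + 1) ≤ 2 * mostar T ∧
    (2 * mostar T ≤ base (Fintype.card V) + defect (∑ w ∈ Y, special T r w) +
        defect (∑ w ∈ Z, special T r w + 1) → ∑ w ∈ Y, special T r w = 2) := by
  have hadj : ∀ w, w ∈ Y ∨ w ∈ Z → T.Adj r w := by
    intro w hw
    rw [← mem_neighborFinset, ← hu]
    simpa using hw
  have hspY : ∀ w ∈ Y, 1 ≤ special T r w ∧ special T r w ≤ (branch T r w).card :=
    fun w hw => special_le_card hT (hadj w (Or.inl hw))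
  have hspZ : ∀ w ∈ Z, 1 ≤ special T r w ∧ special T r w ≤ (branch T r w).card :=
    fun w hw => special_le_card hT (hadj w (Or.inr hw))
  obtain ⟨b1, e1⟩ := forest_bound (Finset.card_pos.1 (by omega)) hspY
  obtain ⟨b2, -⟩ := rooted_bound hZ hspZ
  have hmo := weight_sum_le_mostar hT r
  have hsum := card_eq_sum_branch hT r
  have hK := card_special_eq_sum hT r
  have hdeg : T.degree r ≠ 2 := by
    rw [← card_neighborFinset_eq_degree, ← hu, Finset.card_union_of_disjoint hd]
    omega
  rw [if_neg hdeg] at hK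
  rw [← hu, Finset.sum_union hd] at hmo hsum hK
  have hb := base_eq (n := Fintype.card V) (by omega) hYn hZn
  have hid : 2 * (Fintype.card V : ℤ) * (Fintype.card V - 1) +
      (weight (∑ w ∈ Y, (branch T r w).card) (∑ w ∈ Y, special T r w) +
        weight (∑ w ∈ Z, (branch T r w).card) (∑ w ∈ Z, special T r w + 1)) =
      base (Fintype.card V) + defect (∑ w ∈ Y, special T r w) +
        defect (∑ w ∈ Z, special T r w + 1) := by
    rw [← hb]
    unfold weight
    ring
  refine ⟨by rw [specialCount]; omega, by linarith, fun hge => ?_⟩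
  rcases e1 (by linarith) with h | ⟨h, h'⟩
  · omega
  · rw [Finset.sum_congr rfl fun w hw => le_antisymm ((hspY w hw).2.trans (h' w hw).le)
      (hspY w hw).1, Finset.sum_const, h]
    rfl

end LowerBound

/-! ### Optimal splittings of the number of special vertices. -/

/-- `(α, β)` is, up to order, the only pair of positive integers with sum `K` for which the sum of
the defects is least. -/
structure OptimalPair (K α β : ℕ) : Prop where
  le : ∀ x y, x + y = K → 1 ≤ x → 1 ≤ y → defect α + defect β ≤ defect x + defect y
  eq : ∀ x y, x + y = K → 1 ≤ x → 1 ≤ y → defect x + defect y ≤ defect α + defect β →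
    x = α ∧ y = β ∨ x = β ∧ y = α

theorem defect_odd (a : ℕ) : defect (2 * a + 1) = 4 * (a : ℤ) ^ 2 := by
  unfold defect
  rw [if_neg (by simp)]
  push_cast
  ring

theorem defect_even (a : ℕ) : defect (2 * a + 2) = 4 * ((a : ℤ) ^ 2 + a + 1) := by
  unfold defect
  rw [if_pos ⟨a + 1, by ring⟩]
  push_cast
  ring

/-- Two even parts cost strictly more because of the parity term. Among odd parts, a shift d changes
the cost by 8d² if a = b, and by 8d(d + 1) if a = b + 1, where d = -1 is the swap. -/
theorem optimalPair_even {a b : ℕ} (h : a = b ∨ a = b + 1) :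
    OptimalPair (2 * a + 2 * b + 2) (2 * a + 1) (2 * b + 1) := by
  have key : ∀ x y, x + y = 2 * a + 2 * b + 2 → 1 ≤ x → 1 ≤ y →
      (defect (2 * a + 1) + defect (2 * b + 1) ≤ defect x + defect y) ∧
      (defect x + defect y ≤ defect (2 * a + 1) + defect (2 * b + 1) →
        x = 2 * a + 1 ∧ y = 2 * b + 1 ∨ x = 2 * b + 1 ∧ y = 2 * a + 1) := by
    intro x y hxy hx hy
    rw [defect_odd, defect_odd]
    rcases Nat.even_or_odd x with hx' | ⟨i, rfl⟩
    · obtain ⟨i, rfl⟩ : ∃ i, x = 2 * i + 2 := by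
        obtain ⟨i, rfl⟩ := hx'
        exact ⟨i - 1, by omega⟩
      obtain ⟨j, rfl⟩ : ∃ j, y = 2 * j + 2 := ⟨a + b - i - 1, by omega⟩
      rw [defect_even, defect_even]
      have hij : (i : ℤ) + j + 1 = a + b := by omega
      have : 4 * (a : ℤ) ^ 2 + 4 * (b : ℤ) ^ 2 <
          4 * ((i : ℤ) ^ 2 + i + 1) + 4 * ((j : ℤ) ^ 2 + j + 1) := by
        rcases h with rfl | rfl
        · nlinarith [sq_nonneg ((i : ℤ) - j)]
        · push_cast at hij ⊢
          nlinarith [sq_nonneg ((i : ℤ) - j)]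
      exact ⟨this.le, fun h => absurd h (not_le.2 this)⟩
    · obtain ⟨j, rfl⟩ : ∃ j, y = 2 * j + 1 := ⟨a + b - i, by omega⟩
      rw [defect_odd, defect_odd]
      have hij : (i : ℤ) + j = a + b := by omega
      obtain ⟨d, hd⟩ : ∃ d : ℤ, d = i - a := ⟨_, rfl⟩
      have hi : (i : ℤ) = a + d := by linarith
      have hj : (j : ℤ) = b - d := by linarith
      rw [hi, hj]
      rcases h with rfl | rfl
      · refine ⟨by nlinarith [sq_nonneg d], fun hle => Or.inl ?_⟩
        have : d = 0 := by nlinarith [sq_nonneg d]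
        omega
      · have h1 : d = 0 ∨ d = -1 ∨ 0 < d * (d + 1) := by
          rcases lt_trichotomy d 0 with hd0 | hd0 | hd0
          · by_cases hd1 : d = -1
            · exact Or.inr (Or.inl hd1)
            · exact Or.inr (Or.inr (mul_pos_of_neg_of_neg hd0 (by omega)))
          · exact Or.inl hd0
          · exact Or.inr (Or.inr (by positivity))
        push_cast
        rcases h1 with rfl | rfl | h1
        · exact ⟨by nlinarith, fun _ => Or.inl (by omega)⟩
        · exact ⟨by nlinarith, fun _ => Or.inr (by omega)⟩
        · exact ⟨by nlinarith, fun _ => by nlinarith⟩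
  exact ⟨fun x y h1 h2 h3 => (key x y h1 h2 h3).1, fun x y h1 h2 h3 => (key x y h1 h2 h3).2⟩

/-- Exactly one part is even. Shifting by d costs 4d(2d + 1) or 4d(2d - 1), positive for every
nonzero integer d, so even the order of the halves is determined once the even part is named. -/
theorem optimalPair_odd {c b : ℕ} (h : b = c ∨ b = c + 1) :
    OptimalPair (2 * c + 2 * b + 3) (2 * c + 2) (2 * b + 1) := by
  have main : ∀ i j : ℕ, i + j = c + b →
      (4 * ((c : ℤ) ^ 2 + c + 1) + 4 * (b : ℤ) ^ 2 ≤
        4 * ((i : ℤ) ^ 2 + i + 1) + 4 * (j : ℤ) ^ 2) ∧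
      (4 * ((i : ℤ) ^ 2 + i + 1) + 4 * (j : ℤ) ^ 2 ≤
        4 * ((c : ℤ) ^ 2 + c + 1) + 4 * (b : ℤ) ^ 2 → i = c ∧ j = b) := by
    intro i j hij
    obtain ⟨d, hd⟩ : ∃ d : ℤ, d = i - c := ⟨_, rfl⟩
    have hi : (i : ℤ) = c + d := by linarith
    have hj : (j : ℤ) = b - d := by omega
    have h1 : d = 0 ∨ 0 < d * (2 * d + 1) ∧ 0 < d * (2 * d - 1) := by
      rcases lt_trichotomy d 0 with hd0 | hd0 | hd0
      · exact Or.inr ⟨mul_pos_of_neg_of_neg hd0 (by omega), mul_pos_of_neg_of_neg hd0 (by omega)⟩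
      · exact Or.inl hd0
      · exact Or.inr ⟨mul_pos hd0 (by omega), mul_pos hd0 (by omega)⟩
    rw [hi, hj]
    rcases h1 with rfl | ⟨h1, h2⟩
    · exact ⟨by nlinarith, fun _ => by omega⟩
    · rcases h with rfl | rfl
      · exact ⟨by nlinarith, fun _ => by nlinarith⟩
      · push_cast
        exact ⟨by nlinarith, fun _ => by nlinarith⟩
  have key : ∀ x y, x + y = 2 * c + 2 * b + 3 → 1 ≤ x → 1 ≤ y →
      (defect (2 * c + 2) + defect (2 * b + 1) ≤ defect x + defect y) ∧
      (defect x + defect y ≤ defect (2 * c + 2) + defect (2 * b + 1) →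
        x = 2 * c + 2 ∧ y = 2 * b + 1 ∨ x = 2 * b + 1 ∧ y = 2 * c + 2) := by
    intro x y hxy hx hy
    rw [defect_even, defect_odd]
    rcases Nat.even_or_odd x with hx' | ⟨j, rfl⟩
    · obtain ⟨i, rfl⟩ : ∃ i, x = 2 * i + 2 := by
        obtain ⟨i, rfl⟩ := hx'
        exact ⟨i - 1, by omega⟩
      obtain ⟨j, rfl⟩ : ∃ j, y = 2 * j + 1 := ⟨c + b - i, by omega⟩
      rw [defect_even, defect_odd]
      obtain ⟨m1, m2⟩ := main i j (by omega)
      exact ⟨m1, fun hle => Or.inl (by have := m2 hle; omega)⟩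
    · obtain ⟨i, rfl⟩ : ∃ i, y = 2 * i + 2 := ⟨c + b - j, by omega⟩
      rw [defect_even, defect_odd, add_comm (4 * (j : ℤ) ^ 2)]
      obtain ⟨m1, m2⟩ := main i j (by omega)
      exact ⟨m1, fun hle => Or.inr (by have := m2 hle; omega)⟩
  exact ⟨fun x y h1 h2 h3 => (key x y h1 h2 h3).1, fun x y h1 h2 h3 => (key x y h1 h2 h3).2⟩

/-! ### From the bound to pairs of brooms. -/

section Extremal

variable {V : Type*} [Fintype V] {T : SimpleGraph V}

/-- The two sides of the edge `uv` are brooms, with `α` and `β` vertices not of degree two. -/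
def BroomPair (T : SimpleGraph V) (α β : ℕ) (u v : V) : Prop :=
  T.Adj u v ∧ special T u v = α ∧ special T v u = β ∧
    Broom T v (branch T u v) ((branch T u v).card - α / 2) (pendIndices α) ∧
    Broom T u (branch T v u) ((branch T v u).card - β / 2) (pendIndices β)

/-- `hL` excludes three groups, and its constant 7 is what the optimal pair needs when K is odd. The
assumptions α, β ≠ 2 exclude equality for two groups. -/
theorem mostar_bound (hT : T.IsTree) (hn : 4 ≤ Fintype.card V) {K α β : ℕ}
    (hK : specialCount T = K) (hopt : OptimalPair K α β) (hα : α ≠ 2) (hβ : β ≠ 2)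
    (hL : 2 * (defect α + defect β) ≤ ((K : ℤ) - 2) ^ 2 + 7) :
    base (Fintype.card V) + defect α + defect β ≤ 2 * mostar T ∧
      (2 * mostar T ≤ base (Fintype.card V) + defect α + defect β →
        ∃ u v, BroomPair T α β u v) := by
  subst hK
  rcases mostar_trichotomy hT hn with ⟨r, a, h, h1, h2⟩ | ⟨r, Y, Z, hd, hu, hY, hZ, hYn, hZn⟩ |
    ⟨-, h, -⟩
  · obtain ⟨b1, e1⟩ := mostar_bound_of_edge hT h h1 h2
    have hsum := special_add hT h
    have hp := (special_pos_and_ne_two hT h).1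
    have hp' := (special_pos_and_ne_two hT h.symm).1
    have hle := hopt.le _ _ hsum hp hp'
    refine ⟨by linarith, fun hge => ?_⟩
    obtain ⟨br1, br2⟩ := e1 (by linarith)
    rcases hopt.eq _ _ hsum hp hp' (by linarith) with ⟨ha, hb⟩ | ⟨ha, hb⟩
    · exact ⟨r, a, h, ha, hb, ha ▸ br1, hb ▸ br2⟩
    · exact ⟨a, r, h.symm, hb, ha, hb ▸ br2, ha ▸ br1⟩
  · obtain ⟨hK, b1, e1⟩ := mostar_bound_of_two_groups hT hd hu hY hZ hYn hZn
    have hp : 1 ≤ ∑ w ∈ Y, special T r w := by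
      obtain ⟨w, hw⟩ : Y.Nonempty := Finset.card_pos.1 (by omega)
      refine (special_pos_and_ne_two hT (u := r) (v := w) ?_).1.trans
        (Finset.single_le_sum (f := special T r) (by simp) hw)
      rw [← mem_neighborFinset, ← hu]
      exact Finset.mem_union_left _ hw
    have hle := hopt.le _ _ hK.symm hp (by omega)
    refine ⟨by linarith, fun hge => ?_⟩
    have h2 := e1 (by linarith)
    rcases hopt.eq _ _ hK.symm hp (by omega) (by linarith) with h | h <;> omega
  · exact ⟨by linarith, fun hge => by linarith⟩

/-- A single special vertex means that the branch never forks, so it is a path; no equality of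
bounds is involved. -/
theorem broom_of_special_eq_one (hT : T.IsTree) {u v : V} (h : T.Adj u v)
    (hs : special T u v = 1) :
    Broom T v (branch T u v) (branch T u v).card (pendIndices 1) := by
  induction hk : (branch T u v).card using Nat.strong_induction_on generalizing u v with
  | _ k ih =>
    subst hk
    have hcard := card_branch_eq hT h
    have hspec := special_eq hT h
    have hdeg := children_card h
    have hpos : ∀ w ∈ children T u v, 1 ≤ special T v w := fun w hw =>
      (special_pos_and_ne_two hT (mem_children.1 hw).2).1
    have hle : (children T u v).card ≤ ∑ w ∈ children T u v, special T v w := by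
      rw [Finset.card_eq_sum_ones]
      exact Finset.sum_le_sum hpos
    split_ifs at hspec with hd
    · obtain ⟨w, hw⟩ := Finset.card_eq_one.1 (show (children T u v).card = 1 by omega)
      have hwc : w ∈ children T u v := by simp [hw]
      rw [hw, Finset.sum_singleton] at hcard hspec
      have := (ih _ (Finset.card_lt_card (branch_ssubset hT h hwc)) (mem_children.1 hwc).2
        (by omega) rfl).extend (mem_children.1 hwc).2
      rwa [hcard, branch_eq hT h, hw, Finset.singleton_biUnion, add_comm]
    · have h0 : (children T u v).card = 0 := by omega
      rw [Finset.card_eq_zero] at h0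
      rw [h0, Finset.sum_empty] at hcard
      rw [branch_eq_singleton h (by omega), Finset.card_singleton]
      exact broom_singleton v

theorem broomPair_of_three_leaves (hT : T.IsTree) {r a x y z : V}
    (hN : T.neighborFinset r = {a, x, y, z}) (hax : a ≠ x) (hay : a ≠ y) (haz : a ≠ z)
    (hxy : x ≠ y) (hxz : x ≠ z) (hyz : y ≠ z)
    (hx : (branch T r x).card = 1) (hy : (branch T r y).card = 1) (hz : (branch T r z).card = 1)
    (ha : special T r a = 1) (hK : specialCount T = 5) : BroomPair T 4 1 a r := by
  have hadj : ∀ w ∈ ({a, x, y, z} : Finset V), T.Adj r w := by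
    intro w hw
    rwa [← hN, mem_neighborFinset] at hw
  have h := hadj a (by simp)
  have hch : children T a r = {x, y, z} := by
    rw [children, hN, Finset.erase_insert]
    simp [hax, hay, haz]
  have hbr : branch T a r = {r, x, y, z} := by
    rw [branch_eq hT h.symm, hch, Finset.biUnion_insert, Finset.biUnion_insert,
      Finset.singleton_biUnion, branch_eq_singleton (hadj x (by simp)) hx,
      branch_eq_singleton (hadj y (by simp)) hy, branch_eq_singleton (hadj z (by simp)) hz]
    rfl
  have hcard : (branch T a r).card = 4 := by
    simp [card_branch_eq hT h.symm, hch, hxy, hxz, hyz, hx, hy, hz]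
  have hsp := special_add hT h
  rw [← specialCount, hK] at hsp
  refine ⟨h.symm, by omega, ha, ?_, broom_of_special_eq_one hT h ha⟩
  rw [hcard, hbr]
  exact broom_star (hadj x (by simp)) (hadj y (by simp)) (hadj z (by simp))

/-- If four vertices or chains hang at a common vertex, and the whole is short, then three of them
are single vertices. -/
theorem mostar_bound_five_of_two_groups (hT : T.IsTree) (hK : specialCount T = 5) {r : V}
    {Y Z : Finset V} (hd : Disjoint Y Z) (hu : Y ∪ Z = T.neighborFinset r) (hY : 2 ≤ Y.card)
    (hZ : 2 ≤ Z.card) (hYn : 2 * ∑ w ∈ Y, (branch T r w).card ≤ Fintype.card V)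
    (hZn : 2 * ∑ w ∈ Z, (branch T r w).card ≤ Fintype.card V) :
    (6 ≤ Fintype.card V → base (Fintype.card V) + 12 ≤ 2 * mostar T) ∧
      (Fintype.card V = 5 ∨ 2 * mostar T ≤ base (Fintype.card V) + 12 →
        ∃ u v, BroomPair T 4 1 u v) := by
  have d1 : defect 1 = 0 := by simp [defect]
  obtain ⟨hK', -, -⟩ := mostar_bound_of_two_groups hT hd hu hY hZ hYn hZn
  have hadj : ∀ w, w ∈ Y ∨ w ∈ Z → T.Adj r w := by
    intro w hw
    rw [← mem_neighborFinset, ← hu]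
    simpa using hw
  have hcard : ∀ X : Finset V, (∀ w ∈ X, T.Adj r w) → X.card ≤ ∑ w ∈ X, special T r w := by
    intro X hX
    rw [Finset.card_eq_sum_ones]
    exact Finset.sum_le_sum fun w hw => (special_pos_and_ne_two hT (hX w hw)).1
  have hYs := hcard Y fun w hw => hadj w (Or.inl hw)
  have hZs := hcard Z fun w hw => hadj w (Or.inr hw)
  obtain ⟨w₁, w₂, h12, rfl⟩ := Finset.card_eq_two.1 (show Y.card = 2 by omega)
  obtain ⟨w₃, w₄, h34, rfl⟩ := Finset.card_eq_two.1 (show Z.card = 2 by omega)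
  rw [Finset.sum_pair h12, Finset.sum_pair h34] at hK'
  have hmo := weight_sum_le_mostar hT r
  have hsum := card_eq_sum_branch hT r
  rw [← hu, Finset.sum_union hd, Finset.sum_pair h12, Finset.sum_pair h34] at hmo hsum
  rw [Finset.sum_pair h12] at hYn
  rw [Finset.sum_pair h34] at hZn
  have hb := base_eq (n := Fintype.card V) (by omega) hYn hZn
  have hs := fun w hw => special_le_card hT (hadj w hw)
  obtain ⟨p1, q1⟩ := hs w₁ (by simp)
  obtain ⟨p2, q2⟩ := hs w₂ (by simp)
  obtain ⟨p3, q3⟩ := hs w₃ (by simp)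
  obtain ⟨p4, q4⟩ := hs w₄ (by simp)
  have e1 : special T r w₁ = 1 := by omega
  have e2 : special T r w₂ = 1 := by omega
  have e3 : special T r w₃ = 1 := by omega
  have e4 : special T r w₄ = 1 := by omega
  rw [e1] at q1
  rw [e2] at q2
  rw [e3] at q3
  rw [e4] at q4
  simp only [Finset.disjoint_insert_left, Finset.disjoint_singleton_left, Finset.mem_insert,
    Finset.mem_singleton, not_or] at hd
  obtain ⟨⟨h13, h14⟩, h23, h24⟩ := hd
  have hN : T.neighborFinset r = {w₁, w₂, w₃, w₄} := by
    rw [← hu, Finset.insert_union, Finset.singleton_union]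
  rw [e1, e2, e3, e4] at hmo
  simp only [weight, d1] at hmo
  -- All four branches are chains with zero defect, so the excess comes only from the cross pairs
  -- within each group.
  have hprod : base (Fintype.card V) + 4 * ((branch T r w₁).card * (branch T r w₂).card +
      (branch T r w₃).card * (branch T r w₄).card : ℤ) ≤ 2 * mostar T := by
    rw [← hb]
    push_cast
    linarith
  have hpair : ∀ s t : ℕ, 1 ≤ s → 1 ≤ t → (s : ℤ) + t - 1 ≤ s * t := by
    intro s t hs ht
    have : (0 : ℤ) ≤ ((s : ℤ) - 1) * (t - 1) := mul_nonneg (by omega) (by omega)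
    linarith
  have g1 := hpair _ _ q1 q2
  have g2 := hpair _ _ q3 q4
  refine ⟨fun h6 => ?_, fun hor => ?_⟩
  · have : (5 : ℤ) ≤ (branch T r w₁).card + (branch T r w₂).card + (branch T r w₃).card +
      (branch T r w₄).card := by omega
    linarith
  · have hle : (branch T r w₁).card + (branch T r w₂).card + (branch T r w₃).card +
        (branch T r w₄).card ≤ 5 := by
      rcases hor with h5 | hge
      · omega
      · have : (branch T r w₁).card + (branch T r w₂).card + (branch T r w₃).card +
          (branch T r w₄).card ≤ (5 : ℤ) := by linarith
        exact_mod_cast this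
    have hcases : (branch T r w₂).card = 1 ∧ (branch T r w₃).card = 1 ∧
        (branch T r w₄).card = 1 ∨ (branch T r w₁).card = 1 ∧ (branch T r w₃).card = 1 ∧
        (branch T r w₄).card = 1 ∨ (branch T r w₁).card = 1 ∧ (branch T r w₂).card = 1 ∧
        (branch T r w₄).card = 1 ∨ (branch T r w₁).card = 1 ∧ (branch T r w₂).card = 1 ∧
        (branch T r w₃).card = 1 := by omega
    rcases hcases with ⟨a1, a2, a3⟩ | ⟨a1, a2, a3⟩ | ⟨a1, a2, a3⟩ | ⟨a1, a2, a3⟩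
    · exact ⟨_, _, broomPair_of_three_leaves hT hN h12 h13 h14 h23 h24 h34 a1 a2 a3 e1 hK⟩
    · refine ⟨_, _, broomPair_of_three_leaves hT (a := w₂) (x := w₁) (y := w₃) (z := w₄) ?_
        h12.symm h23 h24 h13 h14 h34 a1 a2 a3 e2 hK⟩
      rw [hN, Finset.insert_comm]
    · refine ⟨_, _, broomPair_of_three_leaves hT (a := w₃) (x := w₁) (y := w₂) (z := w₄) ?_
        (Ne.symm h13) (Ne.symm h23) h34 h12 h14 h24 a1 a2 a3 e3 hK⟩
      rw [hN, Finset.insert_comm w₂ w₃, Finset.insert_comm w₁ w₃]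
    · refine ⟨_, _, broomPair_of_three_leaves hT (a := w₄) (x := w₁) (y := w₂) (z := w₃) ?_
        (Ne.symm h14) (Ne.symm h24) h34.symm h12 h13 h23 a1 a2 a3 e4 hK⟩
      rw [hN, Finset.pair_comm w₃ w₄, Finset.insert_comm w₂ w₄, Finset.insert_comm w₁ w₄]

/-- The splittings (2, 3) and (3, 2) cannot occur, which leaves (1, 4) and (4, 1) at cost 12. The
bound needs n ≥ 6: the star of order 5 has 2Mo = `base 5 + 8`. -/
theorem mostar_bound_five (hT : T.IsTree) (hn : 5 ≤ Fintype.card V) (hK : specialCount T = 5) :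
    (6 ≤ Fintype.card V → base (Fintype.card V) + 12 ≤ 2 * mostar T) ∧
      (Fintype.card V = 5 ∨ 2 * mostar T ≤ base (Fintype.card V) + 12 →
        ∃ u v, BroomPair T 4 1 u v) := by
  have d1 : defect 1 = 0 := by simp [defect]
  have d4 : defect 4 = 12 := by
    have : Even 4 := by decide
    simp [defect, this]
  rcases mostar_trichotomy hT (by omega) with
    ⟨r, a, h, h1, h2⟩ | ⟨r, Y, Z, hd, hu, hY, hZ, hYn, hZn⟩ | ⟨h7, -, h⟩
  · obtain ⟨b1, e1⟩ := mostar_bound_of_edge hT h h1 h2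
    have hsum := special_add hT h
    rw [← specialCount, hK] at hsum
    obtain ⟨hp, hq⟩ := special_pos_and_ne_two hT h
    obtain ⟨hp', hq'⟩ := special_pos_and_ne_two hT h.symm
    have hcard := card_branch_add hT h
    have hl := special_le (T := T) r a
    have hl' := special_le (T := T) a r
    have hcases : special T r a = 1 ∧ special T a r = 4 ∨
        special T r a = 4 ∧ special T a r = 1 := by omega
    have hb : base (Fintype.card V) + 12 ≤ 2 * mostar T := by
      rcases hcases with ⟨hs, hs'⟩ | ⟨hs, hs'⟩ <;> rw [hs, hs', d1, d4] at b1 <;> linarith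
    refine ⟨fun _ => hb, fun hor => ?_⟩
    have hge : 2 * mostar T ≤ base (Fintype.card V) + 12 := by
      rcases hor with h5 | h
      -- For n = 5 the two sides have orders 2 and 3, too few for four special vertices.
      · omega
      · exact h
    rcases hcases with ⟨hs, hs'⟩ | ⟨hs, hs'⟩
    · obtain ⟨br1, br2⟩ := e1 (by rw [hs, hs', d1, d4]; linarith)
      exact ⟨a, r, h.symm, hs', hs, hs' ▸ br2, hs ▸ br1⟩
    · obtain ⟨br1, br2⟩ := e1 (by rw [hs, hs', d1, d4]; linarith)
      exact ⟨r, a, h, hs, hs', hs ▸ br1, hs' ▸ br2⟩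
  · exact mostar_bound_five_of_two_groups hT hK hd hu hY hZ hYn hZn
  · refine ⟨fun _ => by linarith [h hK], fun hor => ?_⟩
    rcases hor with h5 | hge
    · omega
    · linarith [h hK]

end Extremal

/-! ### Identifying a pair of brooms with a path with pendent vertices. -/

section PathWithPendents

variable {m : ℕ} {I : Set ℕ} {f : ℕ → ℕ}

theorem pathWithPendents_inl_inl {x y : Fin m} :
    (pathWithPendents m I f).Adj (Sum.inl x) (Sum.inl y) ↔
      (x : ℕ) + 1 = y ∨ (y : ℕ) + 1 = x := by
  change (pathGraph m).Adj x y ↔ _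
  rw [pathGraph_adj]

theorem pathWithPendents_inl_inr {x : Fin m} {i : I} :
    (pathWithPendents m I f).Adj (Sum.inl x) (Sum.inr i) ↔ (x : ℕ) + 1 = f i := Iff.rfl

theorem pathWithPendents_inr_inl {x : Fin m} {i : I} :
    (pathWithPendents m I f).Adj (Sum.inr i) (Sum.inl x) ↔ (x : ℕ) + 1 = f i := Iff.rfl

theorem pathWithPendents_inr_inr {i j : I} :
    ¬ (pathWithPendents m I f).Adj (Sum.inr i) (Sum.inr j) := fun h => h

theorem pathWithPendents_connected (hm : 1 ≤ m) (hf : ∀ i ∈ I, 1 ≤ f i ∧ f i ≤ m) :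
    (pathWithPendents m I f).Connected := by
  have hpath : ∀ k (hk : k < m), (pathWithPendents m I f).Reachable
      (Sum.inl ⟨0, hm⟩) (Sum.inl ⟨k, hk⟩) := by
    intro k
    induction k with
    | zero => exact fun _ => Reachable.refl _
    | succ k ih =>
      intro hk
      exact (ih (by omega)).trans (pathWithPendents_inl_inl.2 (Or.inl rfl)).reachable
  have hall : ∀ p, (pathWithPendents m I f).Reachable (Sum.inl ⟨0, hm⟩) p := by
    rintro (x | i)
    · exact hpath x x.2
    · obtain ⟨h1, h2⟩ := hf i i.2
      refine (hpath (f i - 1) (by omega)).trans (Adj.reachable ?_)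
      rw [pathWithPendents_inl_inr]
      change f i - 1 + 1 = f i
      omega
  have : Nonempty (Fin m ⊕ I) := ⟨Sum.inl ⟨0, hm⟩⟩
  exact ⟨fun p q => (hall p).symm.trans (hall q)⟩

end PathWithPendents

/-- A connected graph that maps bijectively to a tree is isomorphic to it. -/
theorem nonempty_iso_of_bijective {V W : Type*} {T : SimpleGraph V} {G : SimpleGraph W}
    (hT : T.IsTree) (hG : G.Connected) (φ : W → V) (hφ : Function.Bijective φ)
    (hadj : ∀ x y, G.Adj x y → T.Adj (φ x) (φ y)) : Nonempty (T ≃g G) := by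
  let e := Equiv.ofBijective φ hφ
  have hH : (G.map e.toEmbedding).Connected := (Iso.map e G).connected_iff.1 hG
  have hle : G.map e.toEmbedding ≤ T := by
    intro a b hab
    rw [map_adj] at hab
    obtain ⟨x, y, hxy, rfl, rfl⟩ := hab
    exact hadj x y hxy
  -- Trees are the minimal connected graphs, so the connected image inside T is all of T.
  have hge := (isTree_iff_minimal_connected.1 hT).2 hH hle
  have heq : G.map e.toEmbedding = T := le_antisymm hle hge
  rw [← heq]
  exact ⟨(Iso.map e G).symm⟩

/-- The two spines are joined along uv and the pendent vertices carried along. Oddness of β keeps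
index 1, the only one not attached at its own position, out of the reversed half. -/
theorem nonempty_iso_pathWithPendents {V : Type*} [Fintype V] {T : SimpleGraph V}
    (hT : T.IsTree) {α β m : ℕ} {u v : V} (h : BroomPair T α β u v) (hβ : Odd β)
    {I : Set ℕ} {f : ℕ → ℕ} (hm : m + α / 2 + β / 2 = Fintype.card V)
    (hI : ∀ i, i ∈ I ↔ i ∈ pendIndices α ∨ ∃ j ∈ pendIndices β, i + j = m + 1)
    (hf : ∀ i ∈ I, f i = foot i) (hfin : I.Finite) (hcard : I.ncard ≤ α / 2 + β / 2) :
    Nonempty (T ≃g pathWithPendents m I f) := by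
  obtain ⟨huv, hα', hβ', hbv, hbu⟩ := h
  have hsum := card_branch_add hT huv
  have hle1 := special_le (T := T) u v
  have hle2 := special_le (T := T) v u
  rw [hα'] at hle1
  rw [hβ'] at hle2
  generalize hh1 : (branch T u v).card - α / 2 = h1 at hbv
  generalize hh2 : (branch T v u).card - β / 2 = h2 at hbu
  have hm12 : m = h1 + h2 := by omega
  obtain ⟨sp, pe, s1, s2, s3, s4, s5, s6⟩ := hbv
  obtain ⟨sp', pe', t1, t2, t3, t4, t5, t6⟩ := hbu
  have hI1 : ∀ i ∈ pendIndices α, 1 ≤ i ∧ i ≤ h1 := by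
    intro i hi
    have h3 := s3 i hi
    have h4 : i ≤ foot i := by unfold foot; split_ifs <;> omega
    have h5 := hi.1
    split_ifs at h5 <;> omega
  have hI2 : ∀ i ∈ pendIndices β, 2 ≤ i ∧ i ≤ h2 ∧ foot i = i := by
    intro i hi
    have h3 := t3 i hi
    have h5 := hi.1
    rw [if_neg (Nat.not_even_iff_odd.2 hβ)] at h5
    have h4 : foot i = i := by unfold foot; split_ifs <;> omega
    exact ⟨h5, by omega, h4⟩
  -- The second spine is run backwards: its position j becomes m + 1 - j.
  let P : ℕ → V := fun k => if k ≤ h1 then sp k else sp' (m + 1 - k)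
  have hP1 : ∀ k, k ≤ h1 → P k = sp k := fun k hk => if_pos hk
  have hP2 : ∀ k, h1 < k → P k = sp' (m + 1 - k) := fun k hk => if_neg (by omega)
  have hPadj : ∀ k, 1 ≤ k → k < m → T.Adj (P k) (P (k + 1)) := by
    intro k hk hkm
    rcases lt_trichotomy k h1 with hlt | rfl | hgt
    · rw [hP1 k hlt.le, hP1 (k + 1) hlt]
      exact s4 k hk hlt
    · rw [hP1 k le_rfl, hP2 (k + 1) (by omega), s1, show m + 1 - (k + 1) = h2 by omega, t1]
      exact huv.symm
    · rw [hP2 k hgt, hP2 (k + 1) (by omega)]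
      have := t4 (m + 1 - (k + 1)) (by omega) (by omega)
      rw [show m + 1 - (k + 1) + 1 = m + 1 - k by omega] at this
      exact this.symm
  let φ : Fin m ⊕ I → V := Sum.elim (fun x => P (x + 1))
    (fun i => if (i : ℕ) ∈ pendIndices α then pe i else pe' (m + 1 - i))
  have hpend : ∀ i : I, 1 ≤ f i ∧ f i ≤ m ∧ T.Adj (P (f i)) (φ (Sum.inr i)) := by
    rintro ⟨i, hi⟩
    simp only [φ, Sum.elim_inr]
    rw [hf i hi]
    by_cases hiα : i ∈ pendIndices α
    · have h3 := s3 i hiα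
      obtain ⟨h4, h5⟩ := hI1 i hiα
      rw [if_pos hiα, hP1 _ h3]
      exact ⟨by unfold foot; split_ifs <;> omega, by omega, s5 i hiα⟩
    · rw [if_neg hiα]
      obtain ⟨j, hj, hij⟩ := ((hI i).1 hi).resolve_left hiα
      obtain ⟨h3, h4, h5⟩ := hI2 j hj
      have h6 : foot i = i := by unfold foot; split_ifs <;> omega
      rw [h6, hP2 i (by omega), show m + 1 - i = j by omega]
      have := t5 j hj
      rw [h5] at this
      exact ⟨by omega, by omega, this⟩
  have hsurj : Function.Surjective φ := by
    intro p
    by_cases hp : p ∈ branch T u v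
    · rcases s6 p hp with ⟨i, hi, hi', rfl⟩ | ⟨i, hi, rfl⟩
      · refine ⟨Sum.inl ⟨i - 1, by omega⟩, ?_⟩
        simp only [φ, Sum.elim_inl]
        rw [Nat.sub_add_cancel hi, hP1 i hi']
      · refine ⟨Sum.inr ⟨i, (hI i).2 (Or.inl hi)⟩, ?_⟩
        simp only [φ, Sum.elim_inr]
        rw [if_pos hi]
    · have hp' : p ∈ branch T v u := by
        rwa [mem_branch_comm hT huv.symm]
      rcases t6 p hp' with ⟨i, hi, hi', rfl⟩ | ⟨i, hi, rfl⟩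
      · refine ⟨Sum.inl ⟨m - i, by omega⟩, ?_⟩
        simp only [φ, Sum.elim_inl]
        rw [hP2 _ (by omega), show m + 1 - (m - i + 1) = i by omega]
      · obtain ⟨h3, h4, h5⟩ := hI2 i hi
        refine ⟨Sum.inr ⟨m + 1 - i, (hI _).2 (Or.inr ⟨i, hi, by omega⟩)⟩, ?_⟩
        simp only [φ, Sum.elim_inr]
        rw [if_neg, show m + 1 - (m + 1 - i) = i by omega]
        intro hcon
        have := hI1 _ hcon
        omega
  have : Finite I := hfin
  -- Brooms only cover their sides; injectivity follows because the model has at most as many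
  -- vertices as T.
  have hbij : Function.Bijective φ := by
    refine hsurj.bijective_of_nat_card_le ?_
    rw [Nat.card_sum, Nat.card_fin, Nat.card_eq_fintype_card (α := V)]
    have : Nat.card I = I.ncard := rfl
    omega
  refine nonempty_iso_of_bijective hT (pathWithPendents_connected (by omega) ?_) φ hbij ?_
  · intro i hi
    exact ⟨(hpend ⟨i, hi⟩).1, (hpend ⟨i, hi⟩).2.1⟩
  · rintro (x | i) (y | j) hxy
    · rw [pathWithPendents_inl_inl] at hxy
      simp only [φ, Sum.elim_inl]
      rcases hxy with hxy | hxy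
      · rw [← hxy]
        exact hPadj _ (by omega) (by omega)
      · rw [← hxy]
        exact (hPadj _ (by omega) (by omega)).symm
    · rw [pathWithPendents_inl_inr] at hxy
      have := (hpend j).2.2
      rw [← hxy] at this
      exact this
    · rw [pathWithPendents_inr_inl] at hxy
      have := (hpend i).2.2
      rw [← hxy] at this
      exact this.symm
    · exact absurd hxy pathWithPendents_inr_inr

/-! ### Edge values from cuts with a single edge. -/

section Cut

variable {V : Type*} {G : SimpleGraph V}

/-- A walk from S to y must leave S through xy, so stopping at x saves an edge. -/
theorem exists_shorter_walk {S : Set V} {x y : V} (hy : y ∉ S)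
    (hcut : ∀ p q, G.Adj p q → p ∈ S → q ∉ S → p = x ∧ q = y) {w : V} (hw : w ∈ S)
    (p : G.Walk w y) : ∃ q : G.Walk w x, q.length + 1 ≤ p.length := by
  induction p with
  | nil => exact absurd hw hy
  | @cons w w' _ h p ih =>
    by_cases hw' : w' ∈ S
    · obtain ⟨q, hq⟩ := ih hy hcut hw'
      exact ⟨Walk.cons h q, by simpa using hq⟩
    · obtain ⟨rfl, -⟩ := hcut _ _ h hw hw'
      exact ⟨Walk.nil, by simp⟩

theorem dist_lt_of_cut (hG : G.Connected) {S : Set V} {x y : V} (hy : y ∉ S)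
    (hcut : ∀ p q, G.Adj p q → p ∈ S → q ∉ S → p = x ∧ q = y) {w : V} (hw : w ∈ S) :
    G.dist w x < G.dist w y := by
  obtain ⟨p, hp⟩ := hG.exists_walk_length_eq_dist w y
  obtain ⟨q, hq⟩ := exists_shorter_walk hy hcut hw p
  have := dist_le q
  omega

theorem psi_of_cut [Fintype V] (hG : G.Connected) {S : Finset V} {x y : V} (hx : x ∈ S)
    (hy : y ∉ S) (hcut : ∀ p q, G.Adj p q → p ∈ S → q ∉ S → p = x ∧ q = y) :
    psi G s(x, y) = |(Fintype.card V : ℤ) - 2 * S.card| := by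
  have h1 : ∀ w ∈ S, G.dist w x < G.dist w y := fun w hw =>
    dist_lt_of_cut hG (S := (S : Set V)) (by simpa using hy) (by simpa using hcut)
      (by simpa using hw)
  have h2 : ∀ w ∉ S, G.dist w y < G.dist w x := fun w hw =>
    dist_lt_of_cut hG (S := (S : Set V)ᶜ) (by simpa using hx)
      (fun p q hpq hp hq => (hcut q p hpq.symm (by simpa using hq) (by simpa using hp)).symm)
      (by simpa using hw)
  have h3 : closer G x y = S.card := by
    unfold closer
    congr 1
    ext w
    simp only [Finset.mem_filter, Finset.mem_univ, true_and]
    exact ⟨fun h => by_contra fun hw => (h2 w hw).asymm h, h1 w⟩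
  have h4 : closer G y x = Sᶜ.card := by
    unfold closer
    congr 1
    ext w
    simp only [Finset.mem_filter, Finset.mem_univ, true_and, Finset.mem_compl]
    exact ⟨fun h hw => (h1 w hw).asymm h, h2 w⟩
  have h5 := S.card_add_card_compl
  change |(closer G x y : ℤ) - (closer G y x : ℤ)| = _
  rw [h3, h4, ← h5, abs_sub_comm]
  congr 1
  push_cast
  ring

end Cut

/-! ### Edges, degrees and Mostar index of a path with pendent vertices. -/

section Caterpillar

variable {m : ℕ} {I : Set ℕ} {J : Finset ℕ} {f : ℕ → ℕ}

theorem card_fin_sum [Fintype I] (hJ : ∀ i, i ∈ J ↔ i ∈ I) :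
    Fintype.card (Fin m ⊕ I) = m + J.card := by
  rw [Fintype.card_sum, Fintype.card_fin, Fintype.card_of_subtype J hJ]

theorem card_filter_elim [Fintype I] (hJ : ∀ i, i ∈ J ↔ i ∈ I) (P Q : ℕ → Prop)
    [DecidablePred P] [DecidablePred Q] :
    (Finset.univ.filter fun p : Fin m ⊕ I =>
      Sum.elim (fun x : Fin m => P x) (fun i : I => Q i) p).card =
      ((Finset.range m).filter P).card + (J.filter Q).card := by
  rw [Finset.card_filter, Finset.card_filter, Finset.card_filter, Fintype.sum_sum_type,
    Finset.sum_subtype J hJ, ← Fin.sum_univ_eq_sum_range (fun x => if P x then 1 else 0) m]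
  refine congrArg₂ _ (Finset.sum_congr rfl fun x _ => ?_) (Finset.sum_congr rfl fun x _ => ?_) <;>
    (simp only [Sum.elim_inl, Sum.elim_inr]; congr)

/-- The edges of a path with pendent vertices. -/
def edgeParam (m : ℕ) (I : Set ℕ) (f : ℕ → ℕ) (hf : ∀ i ∈ I, 2 ≤ f i ∧ f i + 1 ≤ m) :
    Fin (m - 1) ⊕ I → Sym2 (Fin m ⊕ I) :=
  Sum.elim (fun j => s(Sum.inl ⟨j, by omega⟩, Sum.inl ⟨j + 1, by omega⟩))
    (fun i => s(Sum.inr i, Sum.inl ⟨f i - 1, by have := hf i i.2; omega⟩))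

theorem edgeSet_subset (hf : ∀ i ∈ I, 2 ≤ f i ∧ f i + 1 ≤ m) :
    ∀ e ∈ (pathWithPendents m I f).edgeSet, ∃ j, edgeParam m I f hf j = e := by
  intro e
  induction e using Sym2.ind with
  | _ p q =>
    rw [mem_edgeSet]
    rcases p with x | i <;> rcases q with y | j <;> intro h
    · rcases pathWithPendents_inl_inl.1 h with h | h
      · refine ⟨Sum.inl ⟨x, by omega⟩, ?_⟩
        simp only [edgeParam, Sum.elim_inl]
        simp only [h]
      · refine ⟨Sum.inl ⟨y, by omega⟩, ?_⟩
        simp only [edgeParam, Sum.elim_inl]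
        rw [Sym2.eq_swap]
        simp only [h]
    · refine ⟨Sum.inr j, ?_⟩
      rw [pathWithPendents_inl_inr] at h
      simp only [edgeParam, Sum.elim_inr]
      rw [Sym2.eq_swap]
      simp only [← h, Nat.add_sub_cancel]
    · refine ⟨Sum.inr i, ?_⟩
      rw [pathWithPendents_inr_inl] at h
      simp only [edgeParam, Sum.elim_inr]
      simp only [← h, Nat.add_sub_cancel]
    · exact absurd h pathWithPendents_inr_inr

variable [Fintype I]

/-- The graph is connected, and `edgeParam` covers its edges with one index fewer than there are
vertices. -/
theorem pathWithPendents_isTree (hm : 1 ≤ m) (hf : ∀ i ∈ I, 2 ≤ f i ∧ f i + 1 ≤ m) :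
    (pathWithPendents m I f).IsTree := by
  have hc : (pathWithPendents m I f).Connected :=
    pathWithPendents_connected hm fun i hi => by have := hf i hi; omega
  rw [isTree_iff_connected_and_card]
  refine ⟨hc, le_antisymm ?_ hc.card_vert_le_card_edgeSet_add_one⟩
  have h1 := (Finset.card_le_card (s := (pathWithPendents m I f).edgeFinset)
    (t := Finset.univ.image (edgeParam m I f hf)) fun e he => by
      simpa using edgeSet_subset hf e (mem_edgeFinset.1 he)).trans Finset.card_image_le
  rw [Nat.card_eq_fintype_card, Nat.card_eq_fintype_card, ← edgeFinset_card]
  rw [Finset.card_univ, Fintype.card_sum, Fintype.card_fin] at h1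
  rw [Fintype.card_sum, Fintype.card_fin]
  omega

theorem psi_nonneg {V : Type*} [Fintype V] (G : SimpleGraph V) (e : Sym2 V) : 0 ≤ psi G e := by
  induction e using Sym2.ind with
  | _ p q => exact abs_nonneg _

theorem psi_spine (hm : 1 ≤ m) (hJ : ∀ i, i ∈ J ↔ i ∈ I) (hf : ∀ i ∈ I, 2 ≤ f i ∧ f i + 1 ≤ m)
    (j : Fin (m - 1)) :
    psi (pathWithPendents m I f) (edgeParam m I f hf (Sum.inl j)) =
      |((m + J.card : ℕ) : ℤ) -
        2 * ((j + 1 + (J.filter fun i => f i ≤ j + 1).card : ℕ) : ℤ)| := by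
  have hc : (pathWithPendents m I f).Connected :=
    pathWithPendents_connected hm fun i hi => by have := hf i hi; omega
  have hcard := card_filter_elim (m := m) hJ (fun x => x < (j : ℕ) + 1)
    (fun i => f i ≤ (j : ℕ) + 1)
  have hr : ((Finset.range m).filter fun x => x < (j : ℕ) + 1).card = j + 1 := by
    rw [show (Finset.range m).filter (fun x => x < (j : ℕ) + 1) = Finset.range (j + 1) by
      ext x
      simp only [Finset.mem_filter, Finset.mem_range]
      omega, Finset.card_range]
  rw [hr] at hcard
  rw [← hcard, ← card_fin_sum hJ]
  refine psi_of_cut hc (by simp) (by simp) ?_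
  rintro (x | i) (y | k) hpq hp hq <;>
    simp only [Finset.mem_filter, Finset.mem_univ, true_and, Sum.elim_inl, Sum.elim_inr] at hp hq
  · rw [pathWithPendents_inl_inl] at hpq
    exact ⟨congrArg _ (Fin.ext (by simp only; omega)), congrArg _ (Fin.ext (by simp only; omega))⟩
  · rw [pathWithPendents_inl_inr] at hpq
    omega
  · rw [pathWithPendents_inr_inl] at hpq
    omega
  · exact absurd hpq pathWithPendents_inr_inr

theorem psi_pendent (hm : 1 ≤ m) (hJ : ∀ i, i ∈ J ↔ i ∈ I)
    (hf : ∀ i ∈ I, 2 ≤ f i ∧ f i + 1 ≤ m) (i : I) :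
    psi (pathWithPendents m I f) (edgeParam m I f hf (Sum.inr i)) =
      |((m + J.card : ℕ) : ℤ) - 2| := by
  have hc : (pathWithPendents m I f).Connected :=
    pathWithPendents_connected hm fun i hi => by have := hf i hi; omega
  rw [← card_fin_sum hJ]
  have := psi_of_cut hc (S := {Sum.inr i})
    (x := Sum.inr i) (y := Sum.inl ⟨f i - 1, by have := hf i i.2; omega⟩) (by simp) (by simp) ?_
  · simpa [edgeParam] using this
  · rintro p (y | k) hpq hp hq
    · rw [Finset.mem_singleton] at hp
      subst hp
      rw [pathWithPendents_inr_inl] at hpq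
      exact ⟨rfl, congrArg _ (Fin.ext (by simp only; omega))⟩
    · rw [Finset.mem_singleton] at hp
      subst hp
      exact absurd hpq pathWithPendents_inr_inr

theorem sum_image_le {α β : Type*} [DecidableEq β] (s : Finset α) (g : α → β) (h : β → ℤ)
    (hh : ∀ b, 0 ≤ h b) :
    ∑ b ∈ s.image g, h b ≤ ∑ a ∈ s, h (g a) := by
  induction s using Finset.induction_on with
  | empty => simp
  | insert a s ha ih =>
    rw [Finset.image_insert, Finset.sum_insert ha]
    by_cases hg : g a ∈ s.image g
    · rw [Finset.insert_eq_of_mem hg]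
      linarith [hh (g a)]
    · rw [Finset.sum_insert hg]
      linarith

theorem mostar_le_sum {V ι : Type*} [Fintype V] [Fintype ι] (G : SimpleGraph V) (g : ι → Sym2 V)
    (hg : ∀ e ∈ G.edgeSet, ∃ j, g j = e) : mostar G ≤ ∑ j, psi G (g j) := by
  have h1 : mostar G ≤ ∑ e ∈ Finset.univ.image g, psi G e := by
    unfold mostar
    refine Finset.sum_le_sum_of_subset_of_nonneg (fun e he => ?_) fun e _ _ => psi_nonneg G e
    rw [Finset.mem_image]
    obtain ⟨j, hj⟩ := hg e (mem_edgeFinset.1 he)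
    exact ⟨j, Finset.mem_univ j, hj⟩
  exact h1.trans (sum_image_le Finset.univ g (psi G) (psi_nonneg G))

/-- An upper bound is all that is needed, so `edgeParam` need only be onto the edges; injectivity is
never checked. -/
theorem mostar_pathWithPendents_le (hm : 3 ≤ m) (hJ : ∀ i, i ∈ J ↔ i ∈ I)
    (hf : ∀ i ∈ I, 2 ≤ f i ∧ f i + 1 ≤ m) :
    mostar (pathWithPendents m I f) ≤
      ∑ j ∈ Finset.range (m - 1), |((m + J.card : ℕ) : ℤ) -
        2 * ((j + 1 + (J.filter fun i => f i ≤ j + 1).card : ℕ) : ℤ)| +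
      J.card * (((m + J.card : ℕ) : ℤ) - 2) := by
  refine (mostar_le_sum _ _ (edgeSet_subset hf)).trans ?_
  rw [Fintype.sum_sum_type]
  refine le_of_eq (congrArg₂ _ ?_ ?_)
  · rw [← Fin.sum_univ_eq_sum_range (fun j => |((m + J.card : ℕ) : ℤ) -
        2 * ((j + 1 + (J.filter fun i => f i ≤ j + 1).card : ℕ) : ℤ)|)]
    exact Finset.sum_congr rfl fun j _ => psi_spine (by omega) hJ hf j
  · rw [Finset.sum_congr rfl fun i _ => psi_pendent (by omega) hJ hf i, Finset.sum_const,
      Finset.card_univ, Fintype.card_of_subtype J hJ, nsmul_eq_mul, abs_of_nonneg]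
    push_cast
    omega

theorem degree_inr (hf : ∀ i ∈ I, 2 ≤ f i ∧ f i + 1 ≤ m) (i : I) :
    (pathWithPendents m I f).degree (Sum.inr i) = 1 := by
  rw [← card_neighborFinset_eq_degree, Finset.card_eq_one]
  have := hf i i.2
  refine ⟨Sum.inl ⟨f i - 1, by omega⟩, ?_⟩
  ext p
  rw [mem_neighborFinset, Finset.mem_singleton]
  rcases p with x | j
  · rw [pathWithPendents_inr_inl, Sum.inl.injEq, Fin.ext_iff]
    simp only
    omega
  · simp [pathWithPendents_inr_inr]

theorem degree_inl_eq_two (hm : 3 ≤ m) (hf : ∀ i ∈ I, 2 ≤ f i ∧ f i + 1 ≤ m) (x : Fin m) :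
    (pathWithPendents m I f).degree (Sum.inl x) = 2 ↔
      1 ≤ (x : ℕ) ∧ (x : ℕ) + 2 ≤ m ∧ ∀ i ∈ I, f i ≠ x + 1 := by
  rw [← card_neighborFinset_eq_degree]
  by_cases hx0 : (x : ℕ) = 0
  · have : (pathWithPendents m I f).neighborFinset (Sum.inl x) = {Sum.inl ⟨1, by omega⟩} := by
      ext p
      rw [mem_neighborFinset, Finset.mem_singleton]
      rcases p with y | j
      · rw [pathWithPendents_inl_inl, Sum.inl.injEq, Fin.ext_iff]
        simp only
        omega
      · have := hf j j.2
        simp only [pathWithPendents_inl_inr, reduceCtorEq, iff_false]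
        omega
    rw [this, Finset.card_singleton]
    omega
  · by_cases hxm : (x : ℕ) + 1 = m
    · have : (pathWithPendents m I f).neighborFinset (Sum.inl x) =
          {Sum.inl ⟨m - 2, by omega⟩} := by
        ext p
        rw [mem_neighborFinset, Finset.mem_singleton]
        rcases p with y | j
        · rw [pathWithPendents_inl_inl, Sum.inl.injEq, Fin.ext_iff]
          simp only
          omega
        · have := hf j j.2
          simp only [pathWithPendents_inl_inr, reduceCtorEq, iff_false]
          omega
      rw [this, Finset.card_singleton]
      omega
    · by_cases hI : ∀ i ∈ I, f i ≠ x + 1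
      · have : (pathWithPendents m I f).neighborFinset (Sum.inl x) =
            {Sum.inl ⟨x - 1, by omega⟩, Sum.inl ⟨x + 1, by omega⟩} := by
          ext p
          rw [mem_neighborFinset, Finset.mem_insert, Finset.mem_singleton]
          rcases p with y | j
          · rw [pathWithPendents_inl_inl, Sum.inl.injEq, Sum.inl.injEq, Fin.ext_iff, Fin.ext_iff]
            simp only
            omega
          · have := hI j j.2
            simp only [pathWithPendents_inl_inr, reduceCtorEq, or_self, iff_false]
            omega
        rw [this, Finset.card_pair]
        · simp only [true_iff]
          exact ⟨by omega, by omega, hI⟩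
        · intro h
          rw [Sum.inl.injEq, Fin.ext_iff] at h
          simp only at h
          omega
      · refine ⟨fun h2 => ?_, fun h => absurd h.2.2 hI⟩
        push Not at hI
        obtain ⟨i, hi, hix⟩ := hI
        have hsub : ({Sum.inl ⟨x - 1, by omega⟩, Sum.inl ⟨x + 1, by omega⟩, Sum.inr ⟨i, hi⟩} :
            Finset (Fin m ⊕ I)) ⊆ (pathWithPendents m I f).neighborFinset (Sum.inl x) := by
          intro p hp
          simp only [Finset.mem_insert, Finset.mem_singleton] at hp
          rw [mem_neighborFinset]
          rcases hp with rfl | rfl | rfl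
          · rw [pathWithPendents_inl_inl]
            simp only
            omega
          · rw [pathWithPendents_inl_inl]
            simp
          · rw [pathWithPendents_inl_inr]
            exact hix.symm
        have h3 := Finset.card_le_card hsub
        rw [Finset.card_eq_three.2 ⟨_, _, _, ?_, by simp, by simp, rfl⟩, h2] at h3
        · omega
        · intro h
          rw [Sum.inl.injEq, Fin.ext_iff] at h
          simp only at h
          omega

/-- The degree-two vertices are the interior spine positions 2, …, m - 1 carrying no pendent vertex.
The image of f is counted because one position may carry two. -/
theorem card_degree_two (hm : 3 ≤ m) (hJ : ∀ i, i ∈ J ↔ i ∈ I)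
    (hf : ∀ i ∈ I, 2 ≤ f i ∧ f i + 1 ≤ m) :
    (Finset.univ.filter fun p => (pathWithPendents m I f).degree p = 2).card +
      (J.image f).card + 2 = m := by
  have h1 : (Finset.univ.filter fun p => (pathWithPendents m I f).degree p = 2) =
      Finset.univ.filter fun p : Fin m ⊕ I =>
        Sum.elim (fun x : Fin m => 1 ≤ (x : ℕ) ∧ (x : ℕ) + 2 ≤ m ∧ ∀ i ∈ I, f i ≠ x + 1)
          (fun i : I => False) p := by
    ext (x | i)
    · simp only [Finset.mem_filter, Finset.mem_univ, true_and, Sum.elim_inl]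
      exact degree_inl_eq_two hm hf x
    · simp only [Finset.mem_filter, Finset.mem_univ, true_and, Sum.elim_inr, iff_false]
      rw [degree_inr hf]
      omega
  rw [h1, card_filter_elim hJ (fun x => 1 ≤ x ∧ x + 2 ≤ m ∧ ∀ i ∈ I, f i ≠ x + 1)
    (fun _ => False)]
  have h2 : ((Finset.range m).filter fun x => 1 ≤ x ∧ x + 2 ≤ m ∧ ∀ i ∈ I, f i ≠ x + 1).image
      (· + 1) = Finset.Icc 2 (m - 1) \ J.image f := by
    ext k
    simp only [Finset.mem_image, Finset.mem_filter, Finset.mem_range, Finset.mem_sdiff,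
      Finset.mem_Icc, not_exists, not_and]
    constructor
    · rintro ⟨x, ⟨-, h3, h4, h5⟩, rfl⟩
      exact ⟨by omega, fun i hi => h5 i ((hJ i).1 hi)⟩
    · rintro ⟨h3, h4⟩
      refine ⟨k - 1, ⟨by omega, by omega, by omega, fun i hi => ?_⟩, by omega⟩
      have := h4 i ((hJ i).2 hi)
      omega
  have h3 : J.image f ⊆ Finset.Icc 2 (m - 1) := by
    intro k hk
    obtain ⟨i, hi, rfl⟩ := Finset.mem_image.1 hk
    have := hf i ((hJ i).1 hi)
    rw [Finset.mem_Icc]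
    omega
  have h4 := Finset.card_sdiff_add_card_eq_card h3
  rw [← h2, Finset.card_image_of_injective _ (add_left_injective 1), Nat.card_Icc] at h4
  rw [Finset.filter_false, Finset.card_empty]
  omega

end Caterpillar

/-! ### Comparing spine sums with the sum for a path. -/

section Sums

theorem le_abs_sub_two_mul (n s : ℤ) : n - 2 * s ≤ |n - 2 * s| := le_abs_self _

/-- Next to the end the spine shows the orders 1, 3, …, 2a - 1. The orders 2, 4, …, 2a of a path are
replaced by pendent edges of value n - 2, costing at most 4j - 2 for each 2j and 2a² in total. -/
theorem side_sum_odd (n : ℤ) (a q : ℕ) (h : a ≤ q) :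
    ∑ k ∈ Finset.range q, |n - 2 * ((k + 1 + min k a : ℕ) : ℤ)| + a * (n - 2) ≤
      ∑ s ∈ Finset.range (q + a), |n - 2 * ((s + 1 : ℕ) : ℤ)| + 2 * (a : ℤ) ^ 2 := by
  induction q, h using Nat.le_induction with
  | base =>
    have h1 : ∀ a : ℕ, ∑ k ∈ Finset.range a, |n - 2 * ((2 * k + 1 : ℕ) : ℤ)| + a * (n - 2) ≤
        ∑ s ∈ Finset.range (a + a), |n - 2 * ((s + 1 : ℕ) : ℤ)| + 2 * (a : ℤ) ^ 2 := by
      intro a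
      induction a with
      | zero => simp
      | succ a ih =>
        rw [Finset.sum_range_succ, show a + 1 + (a + 1) = a + a + 1 + 1 by ring,
          Finset.sum_range_succ, Finset.sum_range_succ, show a + a + 1 = 2 * a + 1 by ring]
        have := le_abs_sub_two_mul n ((2 * a + 1 + 1 : ℕ) : ℤ)
        push_cast at this ih ⊢
        linarith
    refine le_of_eq_of_le ?_ (h1 a)
    congr 1
    refine Finset.sum_congr rfl fun k hk => ?_
    rw [min_eq_left (Finset.mem_range.1 hk).le, show k + 1 + k = 2 * k + 1 by ring]
  | succ q hq ih =>
    rw [Finset.sum_range_succ, show q + 1 + a = q + a + 1 by ring, Finset.sum_range_succ,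
      min_eq_right hq, show q + 1 + a = q + a + 1 by ring]
    linarith

/-- Here the spine shows 1, 4, 6, …, 2c + 2, so the replaced orders are 2 and 3, 5, …, 2c + 1. The
cost is at most 2 + (4 + 8 + ⋯ + 4c) = 2(c² + c + 1). -/
theorem side_sum_even (n : ℤ) (c q : ℕ) (hc : 1 ≤ c) (h : c + 1 ≤ q) :
    ∑ k ∈ Finset.range q,
        |n - 2 * ((k + 1 + (if k = 0 then 0 else min (k + 1) (c + 1)) : ℕ) : ℤ)| +
        (c + 1) * (n - 2) ≤
      ∑ s ∈ Finset.range (q + (c + 1)), |n - 2 * ((s + 1 : ℕ) : ℤ)| +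
        2 * ((c : ℤ) ^ 2 + c + 1) := by
  induction q, h using Nat.le_induction with
  | base =>
    have h1 : ∑ k ∈ Finset.range (c + 1),
        |n - 2 * ((k + 1 + (if k = 0 then 0 else k + 1) : ℕ) : ℤ)| + (c + 1) * (n - 2) ≤
        ∑ s ∈ Finset.range (c + 1 + (c + 1)), |n - 2 * ((s + 1 : ℕ) : ℤ)| +
        2 * ((c : ℤ) ^ 2 + c + 1) := by
      induction c, hc using Nat.le_induction with
      | base =>
        have h2 := le_abs_sub_two_mul n 2
        have h3 := le_abs_sub_two_mul n 3
        simp only [Finset.sum_range_succ, Finset.sum_range_zero]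
        norm_num at h2 h3 ⊢
        linarith
      | succ c hc ih =>
        rw [Finset.sum_range_succ _ (c + 1), if_neg (by omega),
          show c + 1 + 1 + (c + 1 + 1) = c + 1 + (c + 1) + 1 + 1 by ring,
          Finset.sum_range_succ _ (c + 1 + (c + 1) + 1), Finset.sum_range_succ _ (c + 1 + (c + 1))]
        have := le_abs_sub_two_mul n ((c + 1 + (c + 1) + 1 : ℕ) : ℤ)
        push_cast at this ih ⊢
        linarith
    refine le_of_eq_of_le ?_ h1
    congr 1
    refine Finset.sum_congr rfl fun k hk => ?_
    rw [min_eq_left (by have := Finset.mem_range.1 hk; omega)]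
  | succ q hq ih =>
    rw [Finset.sum_range_succ, show q + 1 + (c + 1) = q + (c + 1) + 1 by ring,
      Finset.sum_range_succ, min_eq_right (by omega), if_neg (by omega),
      show q + 1 + (c + 1) = q + (c + 1) + 1 by ring]
    linarith

theorem two_mul_sum_eq_base (n : ℕ) (hn : 1 ≤ n) :
    2 * ∑ s ∈ Finset.range (n - 1), |(n : ℤ) - 2 * ((s + 1 : ℕ) : ℤ)| = base n := by
  induction n using Nat.strong_induction_on with
  | _ n ih =>
    by_cases h1 : n = 1
    · subst h1
      simp [base]
    by_cases h2 : n = 2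
    · subst h2
      simp [base]
    -- Removing the two end edges, each of value n - 2, leaves the sum for n - 2.
    obtain ⟨k, rfl⟩ : ∃ k, n = k + 1 + 2 := ⟨n - 3, by omega⟩
    have hk := ih (k + 1) (by omega) (by omega)
    rw [show k + 1 + 2 - 1 = k + 1 + 1 by omega, Finset.sum_range_succ, Finset.sum_range_succ']
    rw [Nat.add_sub_cancel] at hk
    have h3 : ∑ s ∈ Finset.range k, |((k + 1 + 2 : ℕ) : ℤ) - 2 * ((s + 1 + 1 : ℕ) : ℤ)| =
        ∑ s ∈ Finset.range k, |((k + 1 : ℕ) : ℤ) - 2 * ((s + 1 : ℕ) : ℤ)| := by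
      refine Finset.sum_congr rfl fun s _ => ?_
      congr 1
      push_cast
      ring
    have h4 : |((k + 1 + 2 : ℕ) : ℤ) - 2 * ((0 + 1 : ℕ) : ℤ)| = k + 1 := by
      rw [abs_of_nonneg] <;> push_cast <;> omega
    have h5 : |((k + 1 + 2 : ℕ) : ℤ) - 2 * ((k + 1 + 1 : ℕ) : ℤ)| = k + 1 := by
      rw [abs_of_nonpos] <;> push_cast <;> omega
    rw [h3, h4, h5]
    have h6 : base (k + 1 + 2) = base (k + 1) + 4 * (k + 1) := by
      unfold base
      have : Even (k + 1 + 2) ↔ Even (k + 1) := by rw [Nat.even_add]; simp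
      simp only [this]
      push_cast
      ring
    rw [h6, ← hk]
    ring

/-- The sum over a spine splits into the contributions of its two ends. -/
theorem spine_sum {n m q p : ℕ} {L left right : ℕ → ℕ} (hm : q + p + 1 = m)
    (hleft : ∀ k < q, L k = k + 1 + left k)
    (hright : ∀ k < p, L (m - 2 - k) + (k + 1 + right k) = n) :
    ∑ j ∈ Finset.range (m - 1), |(n : ℤ) - 2 * (L j : ℤ)| =
      ∑ k ∈ Finset.range q, |(n : ℤ) - 2 * ((k + 1 + left k : ℕ) : ℤ)| +
      ∑ k ∈ Finset.range p, |(n : ℤ) - 2 * ((k + 1 + right k : ℕ) : ℤ)| := by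
  rw [show m - 1 = q + p by omega, Finset.sum_range_add]
  congr 1
  · exact Finset.sum_congr rfl fun k hk => by rw [hleft k (Finset.mem_range.1 hk)]
  · rw [← Finset.sum_range_reflect]
    refine Finset.sum_congr rfl fun k hk => ?_
    have hk := Finset.mem_range.1 hk
    have h1 := hright k hk
    rw [show q + (p - 1 - k) = m - 2 - k by omega, abs_sub_comm]
    congr 1
    rw [← h1]
    push_cast
    ring

theorem sum_range_add_reflect {n x y : ℕ} (h : x + y + 1 = n) :
    ∑ s ∈ Finset.range x, |(n : ℤ) - 2 * ((s + 1 : ℕ) : ℤ)| +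
      ∑ s ∈ Finset.range y, |(n : ℤ) - 2 * ((s + 1 : ℕ) : ℤ)| =
      ∑ s ∈ Finset.range (n - 1), |(n : ℤ) - 2 * ((s + 1 : ℕ) : ℤ)| := by
  have := spine_sum (n := n) (m := n) (q := x) (p := y) (L := fun s => s + 1) (left := fun _ => 0)
    (right := fun _ => 0) h (fun k _ => rfl) (fun k hk => by omega)
  simpa using this.symm

end Sums

/-! ### Invariance under isomorphism. -/

section Iso

variable {V W : Type*} {G : SimpleGraph V} {H : SimpleGraph W}

theorem dist_le_of_iso (e : G ≃g H) (hG : G.Connected) (u v : V) :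
    H.dist (e u) (e v) ≤ G.dist u v := by
  obtain ⟨p, hp⟩ := hG.exists_walk_length_eq_dist u v
  rw [← hp, ← Walk.length_map e.toHom p]
  exact dist_le _

theorem dist_iso (e : G ≃g H) (hG : G.Connected) (u v : V) :
    H.dist (e u) (e v) = G.dist u v := by
  refine le_antisymm (dist_le_of_iso e hG u v) ?_
  have := dist_le_of_iso e.symm (e.connected_iff.1 hG) (e u) (e v)
  simpa using this

variable [Fintype V] [Fintype W]

theorem closer_iso (e : G ≃g H) (hG : G.Connected) (u v : V) :
    closer H (e u) (e v) = closer G u v := by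
  unfold closer
  refine (Finset.card_equiv e.toEquiv fun w => ?_).symm
  simp only [Finset.mem_filter, Finset.mem_univ, true_and]
  change _ ↔ H.dist (e w) (e u) < H.dist (e w) (e v)
  rw [dist_iso e hG, dist_iso e hG]

theorem mostar_iso (e : G ≃g H) (hG : G.Connected) : mostar H = mostar G := by
  unfold mostar
  refine (Finset.sum_bij (fun p _ => Sym2.map e p) ?_ ?_ ?_ ?_).symm
  · intro p
    induction p using Sym2.ind with
    | _ x y => simp [e.map_adj_iff]
  · intro p _ q _ h
    exact Sym2.map.injective e.injective h
  · intro p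
    induction p using Sym2.ind with
    | _ x y =>
      intro hp
      refine ⟨s(e.symm x, e.symm y), ?_, by simp⟩
      simpa [e.symm.map_adj_iff] using hp
  · intro p
    induction p using Sym2.ind with
    | _ x y =>
      intro _
      change |(closer G x y : ℤ) - closer G y x| =
        |(closer H (e x) (e y) : ℤ) - closer H (e y) (e x)|
      rw [closer_iso e hG, closer_iso e hG]

theorem mem_treesDegTwo_iso (e : G ≃g H) {t : ℕ} (hG : G ∈ treesDegTwo V t) :
    H ∈ treesDegTwo W t := by
  refine ⟨e.isTree_iff.1 hG.1, ?_⟩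
  rw [← hG.2]
  refine (Finset.card_equiv e.toEquiv fun w => ?_).symm
  simp only [Finset.mem_filter, Finset.mem_univ, true_and]
  rw [← e.degree_eq w]
  rfl

/-- The candidate H lives on another vertex type. Transporting it to V makes it a competitor there,
so a minimiser satisfies the equality condition. -/
theorem isMostarMinimizer_iff {t : ℕ} (hcard : Fintype.card W = Fintype.card V)
    (hH : H ∈ treesDegTwo W t) (hlow : ∀ T ∈ treesDegTwo V t, mostar H ≤ mostar T)
    (huniq : ∀ T ∈ treesDegTwo V t, mostar T ≤ mostar H → Nonempty (T ≃g H))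
    (T : SimpleGraph V) : IsMostarMinimizer t T ↔ Nonempty (T ≃g H) := by
  constructor
  · rintro ⟨hT, hmin⟩
    let e := Fintype.equivOfCardEq hcard
    have hiso : H ≃g H.map e.toEmbedding := Iso.map e H
    have h1 := hmin _ (mem_treesDegTwo_iso hiso hH)
    rw [mostar_iso hiso hH.1.connected] at h1
    exact huniq T hT h1
  · rintro ⟨e⟩
    refine ⟨mem_treesDegTwo_iso e.symm hH, fun T' hT' => ?_⟩
    rw [mostar_iso e.symm hH.1.connected]
    exact hlow T' hT'

theorem specialCount_eq {n t : ℕ} (hV : Fintype.card V = n) {T : SimpleGraph V}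
    (hT : T ∈ treesDegTwo V t) : specialCount T + t = n := by
  have h1 := hT.2
  have h2 := Finset.card_filter_add_card_filter_not (s := (Finset.univ : Finset V))
    (fun v => T.degree v = 2)
  rw [Finset.card_univ, hV, h1] at h2
  have h3 : specialCount T = (Finset.univ.filter fun v => ¬ T.degree v = 2).card := by
    unfold specialCount
    congr
  omega

end Iso

/-! ### The candidates attain the bound. -/

section Extremal

theorem card_Icc_union_Icc {x y z w : ℕ} (h : y < z) :
    (Finset.Icc x y ∪ Finset.Icc z w).card = (y + 1 - x) + (w + 1 - z) := by
  rw [Finset.card_union_of_disjoint, Nat.card_Icc, Nat.card_Icc]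
  rw [Finset.disjoint_left]
  intro i hi hj
  rw [Finset.mem_Icc] at hi hj
  omega

/-- If the pendent vertices beyond the position `q` of the spine sit at its last positions but one,
their number beyond a given position is as expected. -/
theorem card_filter_add_min {J : Finset ℕ} {f : ℕ → ℕ} {m b q k : ℕ}
    (hJ : ∀ i, i ∈ J ∧ q < f i ↔ m - b ≤ i ∧ i + 1 ≤ m) (hf : ∀ i ∈ J, q < f i → f i = i)
    (hb : q + b + 1 ≤ m) (hk : k + q + 1 < m) :
    (J.filter fun i => f i ≤ m - 1 - k).card + min k b = J.card := by
  rw [← Finset.card_filter_add_card_filter_not (s := J) (fun i => f i ≤ m - 1 - k)]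
  congr 1
  have : J.filter (fun i => ¬ f i ≤ m - 1 - k) = Finset.Icc (m - min k b) (m - 1) := by
    ext i
    rw [Finset.mem_filter, Finset.mem_Icc]
    constructor
    · rintro ⟨h1, h2⟩
      have h3 := hf i h1 (by omega)
      have h4 := (hJ i).1 ⟨h1, by omega⟩
      omega
    · intro h1
      obtain ⟨h2, h3⟩ := (hJ i).2 (by omega)
      have h4 := hf i h2 h3
      exact ⟨h2, by omega⟩
  rw [this, Nat.card_Icc]
  omega

/-- The spine is cut after its first a + 1 edges. Each end is compared with a path, and the two path
sums recombine to `base`. -/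
theorem pathWithPendents_extremal_even {m a b t : ℕ} {I : Set ℕ} [Fintype I] (ha : 1 ≤ a)
    (hm : m = t + a + b + 2)
    (hI : ∀ i, i ∈ I ↔ 2 ≤ i ∧ i ≤ a + 1 ∨ m - b ≤ i ∧ i + 1 ≤ m) :
    Fintype.card (Fin m ⊕ I) = t + 2 * a + 2 * b + 2 ∧
      pathWithPendents m I (fun i => i) ∈ treesDegTwo (Fin m ⊕ I) t ∧
      2 * mostar (pathWithPendents m I (fun i => i)) ≤
        base (t + 2 * a + 2 * b + 2) + defect (2 * a + 1) + defect (2 * b + 1) := by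
  obtain ⟨J, hJdef⟩ : ∃ J, J = Finset.Icc 2 (a + 1) ∪ Finset.Icc (m - b) (m - 1) := ⟨_, rfl⟩
  have hmem : ∀ i, i ∈ J ↔ 2 ≤ i ∧ i ≤ a + 1 ∨ m - b ≤ i ∧ i + 1 ≤ m := by
    intro i
    rw [hJdef, Finset.mem_union, Finset.mem_Icc, Finset.mem_Icc]
    omega
  have hJ : ∀ i, i ∈ J ↔ i ∈ I := fun i => by rw [hmem, hI]
  have hcard : J.card = a + b := by
    rw [hJdef, card_Icc_union_Icc (by omega)]
    omega
  have hf : ∀ i ∈ I, 2 ≤ i ∧ i + 1 ≤ m := by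
    intro i hi
    have := (hI i).1 hi
    omega
  have hn : m + J.card = t + 2 * a + 2 * b + 2 := by omega
  refine ⟨by rw [card_fin_sum hJ, hn], ⟨pathWithPendents_isTree (by omega) hf, ?_⟩, ?_⟩
  · have := card_degree_two (by omega) hJ hf
    rw [Finset.image_id', hcard] at this
    omega
  · have hmo := mostar_pathWithPendents_le (by omega) hJ hf
    rw [spine_sum (n := m + J.card) (m := m) (q := a + 1) (p := m - a - 2)
      (left := fun k => min k a) (right := fun k => min k b) (by omega) ?_ ?_] at hmo
    · have s1 := side_sum_odd ((m + J.card : ℕ) : ℤ) a (a + 1) (by omega)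
      have s2 := side_sum_odd ((m + J.card : ℕ) : ℤ) b (m - a - 2) (by omega)
      have s3 := sum_range_add_reflect (n := m + J.card) (x := a + 1 + a) (y := m - a - 2 + b)
        (by omega)
      have s4 := two_mul_sum_eq_base (m + J.card) (by omega)
      have s5 : (J.card : ℤ) = a + b := by exact_mod_cast hcard
      rw [← hn, defect_odd, defect_odd]
      rw [s5] at hmo
      linarith
    · intro k hk
      congr 1
      have : J.filter (fun i => i ≤ k + 1) = Finset.Icc 2 (k + 1) := by
        ext i
        rw [Finset.mem_filter, hmem, Finset.mem_Icc]
        omega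
      rw [this, Nat.card_Icc]
      omega
    · intro k hk
      have := card_filter_add_min (J := J) (f := fun i => i) (m := m) (b := b) (q := a + 1) (k := k)
        (fun i => by rw [hmem]; omega) (fun i _ _ => rfl) (by omega) (by omega)
      rw [show m - 2 - k + 1 = m - 1 - k by omega]
      omega

theorem pathWithPendents_extremal_odd {m c b t : ℕ} {I : Set ℕ} [Fintype I] (hc : 1 ≤ c)
    (hm : m = t + c + b + 2)
    (hI : ∀ i, i ∈ I ↔ 1 ≤ i ∧ i ≤ c + 1 ∨ m - b ≤ i ∧ i + 1 ≤ m) :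
    Fintype.card (Fin m ⊕ I) = t + 2 * c + 2 * b + 3 ∧
      pathWithPendents m I foot ∈ treesDegTwo (Fin m ⊕ I) t ∧
      2 * mostar (pathWithPendents m I foot) ≤
        base (t + 2 * c + 2 * b + 3) + defect (2 * c + 2) + defect (2 * b + 1) := by
  obtain ⟨J, hJdef⟩ : ∃ J, J = Finset.Icc 1 (c + 1) ∪ Finset.Icc (m - b) (m - 1) := ⟨_, rfl⟩
  have hmem : ∀ i, i ∈ J ↔ 1 ≤ i ∧ i ≤ c + 1 ∨ m - b ≤ i ∧ i + 1 ≤ m := by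
    intro i
    rw [hJdef, Finset.mem_union, Finset.mem_Icc, Finset.mem_Icc]
    omega
  have hJ : ∀ i, i ∈ J ↔ i ∈ I := fun i => by rw [hmem, hI]
  have hcard : J.card = c + 1 + b := by
    rw [hJdef, card_Icc_union_Icc (by omega)]
    omega
  have hfoot : ∀ i, i = 1 ∧ foot i = 2 ∨ i ≠ 1 ∧ foot i = i := by
    intro i
    unfold foot
    split_ifs with h
    · exact Or.inl ⟨h, rfl⟩
    · exact Or.inr ⟨h, rfl⟩
  have hf : ∀ i ∈ I, 2 ≤ foot i ∧ foot i + 1 ≤ m := by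
    intro i hi
    have h1 := (hI i).1 hi
    have h2 := hfoot i
    omega
  have hn : m + J.card = t + 2 * c + 2 * b + 3 := by omega
  refine ⟨by rw [card_fin_sum hJ, hn], ⟨pathWithPendents_isTree (by omega) hf, ?_⟩, ?_⟩
  · have h1 := card_degree_two (by omega) hJ hf
    have h2 : J.image foot = Finset.Icc 2 (c + 1) ∪ Finset.Icc (m - b) (m - 1) := by
      ext k
      rw [Finset.mem_image, Finset.mem_union, Finset.mem_Icc, Finset.mem_Icc]
      constructor
      · rintro ⟨i, hi, rfl⟩
        have h1 := (hmem i).1 hi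
        have h2 := hfoot i
        omega
      · intro hk
        refine ⟨k, (hmem k).2 (by omega), ?_⟩
        have h2 := hfoot k
        omega
    rw [h2, card_Icc_union_Icc (by omega)] at h1
    omega
  · have hmo := mostar_pathWithPendents_le (by omega) hJ hf
    rw [spine_sum (n := m + J.card) (m := m) (q := c + 1) (p := m - c - 2)
      (left := fun k => if k = 0 then 0 else min (k + 1) (c + 1)) (right := fun k => min k b)
      (by omega) ?_ ?_] at hmo
    · have s1 := side_sum_even ((m + J.card : ℕ) : ℤ) c (c + 1) hc le_rfl
      have s2 := side_sum_odd ((m + J.card : ℕ) : ℤ) b (m - c - 2) (by omega)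
      have s3 := sum_range_add_reflect (n := m + J.card) (x := c + 1 + (c + 1))
        (y := m - c - 2 + b) (by omega)
      have s4 := two_mul_sum_eq_base (m + J.card) (by omega)
      have s5 : (J.card : ℤ) = c + 1 + b := by exact_mod_cast hcard
      rw [← hn, defect_even, defect_odd]
      rw [s5] at hmo
      linarith
    · intro k hk
      congr 1
      by_cases hk0 : k = 0
      · subst hk0
        rw [if_pos rfl, Finset.card_eq_zero, Finset.filter_eq_empty_iff]
        intro i hi
        have h1 := (hmem i).1 hi
        have h2 := hfoot i
        omega
      · have : J.filter (fun i => foot i ≤ k + 1) = Finset.Icc 1 (k + 1) := by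
          ext i
          have h2 := hfoot i
          rw [Finset.mem_filter, hmem, Finset.mem_Icc]
          omega
        rw [this, Nat.card_Icc, if_neg hk0]
        omega
    · intro k hk
      have := card_filter_add_min (J := J) (f := foot) (m := m) (b := b) (q := c + 1) (k := k)
        (fun i => by have h2 := hfoot i; rw [hmem]; omega)
        (fun i _ _ => by have h2 := hfoot i; omega) (by omega) (by omega)
      rw [show m - 2 - k + 1 = m - 1 - k by omega]
      omega

end Extremal

/-! ### The minimisers in each parity class. -/

section Main

variable {V : Type*} [Fintype V]

theorem mem_pendIndices_odd {a i : ℕ} : i ∈ pendIndices (2 * a + 1) ↔ 2 ≤ i ∧ i ≤ a + 1 := by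
  unfold pendIndices
  rw [if_neg (by simp), Set.mem_Icc]
  omega

theorem mem_pendIndices_even {c i : ℕ} : i ∈ pendIndices (2 * c + 2) ↔ 1 ≤ i ∧ i ≤ c + 1 := by
  unfold pendIndices
  rw [if_pos ⟨c + 1, by ring⟩, Set.mem_Icc]
  omega

theorem ncard_eq_card {I : Set ℕ} {m k : ℕ} [Fintype I]
    (h : Fintype.card (Fin m ⊕ I) = m + k) : I.ncard = k := by
  rw [Fintype.card_sum, Fintype.card_fin] at h
  rw [← Nat.card_coe_set_eq, Nat.card_eq_fintype_card]
  omega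

theorem nonempty_iso_even {m a b t : ℕ} {I : Set ℕ} [Fintype I] (ha : 1 ≤ a)
    (hm : m = t + a + b + 2) (hI : ∀ i, i ∈ I ↔ 2 ≤ i ∧ i ≤ a + 1 ∨ m - b ≤ i ∧ i + 1 ≤ m)
    (hV : Fintype.card V = t + 2 * a + 2 * b + 2) {T : SimpleGraph V} (hT : T.IsTree) {u v : V}
    (h : BroomPair T (2 * a + 1) (2 * b + 1) u v) :
    Nonempty (T ≃g pathWithPendents m I (fun i => i)) := by
  have hcard := (pathWithPendents_extremal_even ha hm hI).1
  refine nonempty_iso_pathWithPendents hT h ⟨b, rfl⟩ (by omega) (fun i => ?_) (fun i hi => ?_)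
    (Set.toFinite I) ?_
  · rw [hI, mem_pendIndices_odd]
    refine or_congr Iff.rfl ⟨fun hi => ⟨m + 1 - i, ?_, by omega⟩, ?_⟩
    · rw [mem_pendIndices_odd]
      omega
    · rintro ⟨j, hj, hij⟩
      rw [mem_pendIndices_odd] at hj
      omega
  · have := (hI i).1 hi
    unfold foot
    rw [if_neg (by omega)]
  · rw [ncard_eq_card (k := a + b) (by rw [hcard]; omega)]
    omega

theorem nonempty_iso_odd {m c b t : ℕ} {I : Set ℕ} [Fintype I] (hc : 1 ≤ c)
    (hm : m = t + c + b + 2) (hI : ∀ i, i ∈ I ↔ 1 ≤ i ∧ i ≤ c + 1 ∨ m - b ≤ i ∧ i + 1 ≤ m)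
    (hV : Fintype.card V = t + 2 * c + 2 * b + 3) {T : SimpleGraph V} (hT : T.IsTree) {u v : V}
    (h : BroomPair T (2 * c + 2) (2 * b + 1) u v) :
    Nonempty (T ≃g pathWithPendents m I foot) := by
  have hcard := (pathWithPendents_extremal_odd hc hm hI).1
  refine nonempty_iso_pathWithPendents hT h ⟨b, rfl⟩ (by omega) (fun i => ?_) (fun i hi => rfl)
    (Set.toFinite I) ?_
  · rw [hI, mem_pendIndices_even]
    refine or_congr Iff.rfl ⟨fun hi => ⟨m + 1 - i, ?_, by omega⟩, ?_⟩
    · rw [mem_pendIndices_odd]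
      omega
    · rintro ⟨j, hj, hij⟩
      rw [mem_pendIndices_odd] at hj
      omega
  · rw [ncard_eq_card (k := c + 1 + b) (by rw [hcard]; omega)]
    omega

theorem isMostarMinimizer_iff_even {n m t a b : ℕ} {I : Set ℕ} [Fintype I]
    (hV : Fintype.card V = n) (hn : n = t + 2 * a + 2 * b + 2) (ha : 1 ≤ a)
    (hab : a = b ∨ a = b + 1) (hm : m = t + a + b + 2)
    (hI : ∀ i, i ∈ I ↔ 2 ≤ i ∧ i ≤ a + 1 ∨ m - b ≤ i ∧ i + 1 ≤ m) (T : SimpleGraph V) :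
    IsMostarMinimizer t T ↔ Nonempty (T ≃g pathWithPendents m I fun i => i) := by
  obtain ⟨h1, h2, h3⟩ := pathWithPendents_extremal_even ha hm hI
  rw [← hn, ← hV] at h1 h3
  have hbound : ∀ T ∈ treesDegTwo V t,
      base (Fintype.card V) + defect (2 * a + 1) + defect (2 * b + 1) ≤ 2 * mostar T ∧
      (2 * mostar T ≤ base (Fintype.card V) + defect (2 * a + 1) + defect (2 * b + 1) →
        ∃ u v, BroomPair T (2 * a + 1) (2 * b + 1) u v) := by
    intro T hT
    have hK := specialCount_eq hV hT
    refine mostar_bound hT.1 (by omega) (show specialCount T = 2 * a + 2 * b + 2 by omega)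
      (optimalPair_even hab) (by omega) (by omega) ?_
    rw [defect_odd, defect_odd]
    rcases hab with rfl | rfl <;> push_cast <;> nlinarith
  refine isMostarMinimizer_iff h1 h2 (fun T hT => ?_) (fun T hT hle => ?_) T
  · linarith [(hbound T hT).1]
  · obtain ⟨u, v, h⟩ := (hbound T hT).2 (by linarith)
    exact nonempty_iso_even ha hm hI (by omega) hT.1 h

theorem isMostarMinimizer_iff_odd {n m t c b : ℕ} {I : Set ℕ} [Fintype I]
    (hV : Fintype.card V = n) (hn : n = t + 2 * c + 2 * b + 3) (hc : 1 ≤ c)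
    (hcb : b = c ∨ b = c + 1) (hm : m = t + c + b + 2)
    (hI : ∀ i, i ∈ I ↔ 1 ≤ i ∧ i ≤ c + 1 ∨ m - b ≤ i ∧ i + 1 ≤ m) (T : SimpleGraph V) :
    IsMostarMinimizer t T ↔ Nonempty (T ≃g pathWithPendents m I foot) := by
  obtain ⟨h1, h2, h3⟩ := pathWithPendents_extremal_odd hc hm hI
  rw [← hn, ← hV] at h1 h3
  have hbound : ∀ T ∈ treesDegTwo V t,
      base (Fintype.card V) + defect (2 * c + 2) + defect (2 * b + 1) ≤ 2 * mostar T ∧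
      (2 * mostar T ≤ base (Fintype.card V) + defect (2 * c + 2) + defect (2 * b + 1) →
        ∃ u v, BroomPair T (2 * c + 2) (2 * b + 1) u v) := by
    intro T hT
    have hK := specialCount_eq hV hT
    refine mostar_bound hT.1 (by omega) (show specialCount T = 2 * c + 2 * b + 3 by omega)
      (optimalPair_odd hcb) (by omega) (by omega) ?_
    rw [defect_even, defect_odd]
    rcases hcb with rfl | rfl <;> push_cast <;> nlinarith
  refine isMostarMinimizer_iff h1 h2 (fun T hT => ?_) (fun T hT hle => ?_) T
  · linarith [(hbound T hT).1]
  · obtain ⟨u, v, h⟩ := (hbound T hT).2 (by linarith)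
    exact nonempty_iso_odd hc hm hI (by omega) hT.1 h

theorem isMostarMinimizer_iff_five {n m t : ℕ} {I : Set ℕ} [Fintype I]
    (hV : Fintype.card V = n) (hn : n = t + 5) (hm : m = t + 3)
    (hI : ∀ i, i ∈ I ↔ 1 ≤ i ∧ i ≤ 2) (T : SimpleGraph V) :
    IsMostarMinimizer t T ↔ Nonempty (T ≃g pathWithPendents m I foot) := by
  -- This is the odd family with c = 1 and b = 0, outside the balanced range of `optimalPair_odd`.
  have hm' : m = t + 1 + 0 + 2 := by omega
  have hI' : ∀ i, i ∈ I ↔ 1 ≤ i ∧ i ≤ 1 + 1 ∨ m - 0 ≤ i ∧ i + 1 ≤ m := by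
    intro i
    rw [hI]
    omega
  obtain ⟨h1, h2, h3⟩ := pathWithPendents_extremal_odd le_rfl hm' hI'
  rw [show t + 2 * 1 + 2 * 0 + 3 = Fintype.card V by omega] at h1 h3
  rw [defect_even, defect_odd] at h3
  norm_num at h3
  have hbound := fun T (hT : T ∈ treesDegTwo V t) =>
    mostar_bound_five hT.1 (by omega) (by have := specialCount_eq hV hT; omega)
  have hiso : ∀ T ∈ treesDegTwo V t,
      (∃ u v, BroomPair T 4 1 u v) → Nonempty (T ≃g pathWithPendents m I foot) := by
    rintro T hT ⟨u, v, h⟩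
    exact nonempty_iso_odd le_rfl hm' hI' (by omega) hT.1 h
  refine isMostarMinimizer_iff h1 h2 (fun T hT => ?_) (fun T hT hle => ?_) T
  -- For order 5 the bound with 12 fails, but every competitor is isomorphic to the candidate.
  · by_cases h5 : Fintype.card V = 5
    · obtain ⟨e⟩ := hiso T hT ((hbound T hT).2 (Or.inl h5))
      exact (mostar_iso e hT.1.connected).le
    · linarith [(hbound T hT).1 (by omega)]
  · exact hiso T hT ((hbound T hT).2 (Or.inr (by linarith)))

theorem isMostarMinimizer_iff_graphC {n t a b : ℕ} (hV : Fintype.card V = n)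
    (hn : n = t + 2 * a + 2 * b + 2) (ha : 1 ≤ a) (hab : a = b ∨ a = b + 1)
    (T : SimpleGraph V) : IsMostarMinimizer t T ↔ Nonempty (T ≃g graphC n a b) := by
  refine isMostarMinimizer_iff_even hV hn ha hab (by omega) (fun i => ?_) T
  rw [Set.mem_union, Set.mem_Icc, Set.mem_Icc]
  omega

theorem isMostarMinimizer_iff_graphF {n t c b : ℕ} (hV : Fintype.card V = n)
    (hn : n = t + 2 * c + 2 * b + 3) (hc : 1 ≤ c) (hcb : b = c ∨ b = c + 1)
    (T : SimpleGraph V) : IsMostarMinimizer t T ↔ Nonempty (T ≃g graphF n (c - 1) b) := by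
  refine isMostarMinimizer_iff_odd hV hn hc hcb (by omega) (fun i => ?_) T
  rw [Set.mem_union, Set.mem_union, Set.mem_singleton_iff, Set.mem_Icc, Set.mem_Icc]
  omega

theorem isMostarMinimizer_iff_graphF_zero {n t : ℕ} (hV : Fintype.card V = n)
    (hn : n = t + 5) (T : SimpleGraph V) :
    IsMostarMinimizer t T ↔ Nonempty (T ≃g graphF n 0 0) := by
  refine isMostarMinimizer_iff_five hV hn (by omega) (fun i => ?_) T
  rw [Set.mem_union, Set.mem_union, Set.mem_singleton_iff, Set.mem_Icc, Set.mem_Icc]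
  omega

end Main

end MostarTrees

theorem mainTheorem3 {V : Type*} [Fintype V] (n t : ℕ) (hV : Fintype.card V = n)
    (ht : t + 4 ≤ n) (T : SimpleGraph V) :
    (n - t = 5 →
      (MostarTrees.IsMostarMinimizer t T ↔ Nonempty (T ≃g MostarTrees.graphF n 0 0))) ∧
    (Odd (n - t) → 7 ≤ n - t →
      (MostarTrees.IsMostarMinimizer t T ↔
        Nonempty (T ≃g MostarTrees.graphF n
          (⌈((n : ℚ) - (t : ℚ) - 5) / 4⌉₊ - 1) (⌊((n : ℚ) - (t : ℚ) - 5) / 4⌋₊ + 1)))) ∧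
    (Even (n - t) →
      (MostarTrees.IsMostarMinimizer t T ↔
        Nonempty (T ≃g MostarTrees.graphC n
          ⌈((n : ℚ) - (t : ℚ)) / 4 - 1 / 2⌉₊ ⌊((n : ℚ) - (t : ℚ)) / 4 - 1 / 2⌋₊))) := by
  have half : ∀ j : ℕ, ⌈((j : ℚ) + 1 / 2)⌉₊ = j + 1 ∧ ⌊((j : ℚ) + 1 / 2)⌋₊ = j := by
    intro j
    constructor
    · rw [Nat.ceil_eq_iff (by omega)]
      push_cast
      constructor <;> linarith
    · rw [Nat.floor_eq_iff (by positivity)]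
      constructor <;> linarith
  refine ⟨fun h => ?_, fun hodd h7 => ?_, fun heven => ?_⟩
  · exact MostarTrees.isMostarMinimizer_iff_graphF_zero hV (by omega) T
  · obtain ⟨k, hk⟩ : ∃ k, n = t + 2 * k + 5 := by
      obtain ⟨k, hk⟩ := hodd
      exact ⟨k - 2, by omega⟩
    -- The quotient equals k/2. For k = 2j the pair (c, b) is (j, j + 1), and for k = 2j + 1 it is
    -- (j + 1, j + 1); the first index of F is c - 1, since u₁ is attached separately.
    rcases Nat.even_or_odd' k with ⟨j, rfl | rfl⟩
    · have e : ((n : ℚ) - (t : ℚ) - 5) / 4 = j := by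
        rw [hk]
        push_cast
        ring
      rw [e, Nat.ceil_natCast, Nat.floor_natCast]
      exact MostarTrees.isMostarMinimizer_iff_graphF hV (by omega) (by omega) (Or.inr rfl) T
    · have e : ((n : ℚ) - (t : ℚ) - 5) / 4 = j + 1 / 2 := by
        rw [hk]
        push_cast
        ring
      rw [e, (half j).1, (half j).2]
      exact MostarTrees.isMostarMinimizer_iff_graphF hV (by omega) (by omega) (Or.inl rfl) T
  · obtain ⟨k, hk⟩ : ∃ k, n = t + 2 * k + 2 := by
      obtain ⟨k, hk⟩ := heven
      exact ⟨k - 1, by omega⟩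
    rcases Nat.even_or_odd' k with ⟨j, rfl | rfl⟩
    · have e : ((n : ℚ) - (t : ℚ)) / 4 - 1 / 2 = j := by
        rw [hk]
        push_cast
        ring
      rw [e, Nat.ceil_natCast, Nat.floor_natCast]
      exact MostarTrees.isMostarMinimizer_iff_graphC hV (by omega) (by omega) (Or.inl rfl) T
    · have e : ((n : ℚ) - (t : ℚ)) / 4 - 1 / 2 = j + 1 / 2 := by
        rw [hk]
        push_cast
        ring
      rw [e, (half j).1, (half j).2]
      exact MostarTrees.isMostarMinimizer_iff_graphC hV (by omega) (by omega) (Or.inr rfl) T
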